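/- **Model.** Let $\mu$ be a probability measure on $\mathbb R$ symmetric about $0$, let $h\sim\mu$, and let $\theta>0$. For a field $\mathbf h=(h_1,\dots,h_n)$ with i.i.d. coordinates of law $\mu$ and $S\subset[n]$ with $|S|=k$, let, for $\sigma\in\{-1,1\}^n$, $$\mathbb P_0(\sigma\mid\mathbf h)\propto\exp\Big(\sum_{i=1}^n h_i\sigma_i\Big),\qquad \mathbb P_S(\sigma\mid\mathbf h)\propto\exp\Big(\frac{\theta}{2k}\Big(\sum_{i\in S}\sigma_i\Big)^2+\sum_{i=1}^n h_i\sigma_i\Big),$$ each normalized to a probability on $\{-1,1\}^n$, and let $\mathbb P_0(\sigma)=\mathbb E_{\mathbf h}\,\mathbb P_0(\sigma\mid\mathbf h)$, $\mathbb P_S(\sigma)=\mathbb E_{\mathbf h}\,\mathbb P_S(\sigma\mid\mathbf h)$. One observes $m$ i.i.d. configurations (each with its own unobserved field), drawn from $\mathbb P_0$ under $H_0$ and from $\mathbb P_S$ for some unknown $S$ with $|S|=k$ under $H_1$. A test $\varphi$ maps the sample to a rejection probability in $[0,1]$; its risk is $\mathbb E_{0}^{\otimes m}[\varphi]+\max_{|S|=k}\mathbb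 E_{S}^{\otimes m}[1-\varphi]$. For sequences $k=k_n$ and $m=m_n$, all tests are *asymptotically powerless* if every sequence of tests $\varphi_n$ has $\liminf_{n\to\infty}\mathrm{risk}(\varphi_n)\ge1$. **High temperature.** Assume $0<\theta<1/\mathbb E[\operatorname{sech}^2h]$ and that $x=0$ is the unique global minimizer over $\mathbb R$ of $x\mapsto \frac{x^2}{2}-\mathbb E\big[\log\cosh(\sqrt\theta x+h)-\log\cosh h\big]$. **Theorem.** Let $\mu$ and $\theta$ be fixed, and let $2\le k_n\le n$ for all large $n$. 1. Suppose $k=o(n^{2/3})$. (a) If $\theta<\frac{1}{2\mathbb E[\operatorname{sech}^2h]}$, all tests are asymptotically powerless whenever $m=o(k\log n)$ and $m=o(n^2/k^2)$. (The second condition follows from the first when $k=O(n^{2/3}(\log n)^{-1/3})$.) (b) If $\theta\in\big[\frac{1}{2\mathbb E[\operatorname{sech}^2h]},\frac{1}{\mathbb E[\operatorname{sech}^2h]}\big)$, all tests are asymptotically powerless whenever $m=o\big(\frac{k}{\log k}\log n\big)$. 2. If $k=\Omega(n^{2/3})$, all tests are asymptotically powerless whenever $m=o(n^2/k^2)$.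 -/

import Mathlib

open MeasureTheory Filter Asymptotics

namespace PlantedRFCW

/-- A configuration of `n` spins, each equal to `1` or `-1`. -/
abbrev Config (n : ℕ) : Type := Fin n → ℤˣ

/-- The real value `1` or `-1` of a spin. -/
def spin (s : ℤˣ) : ℝ := ((s : ℤ) : ℝ)

/-- The Gibbs probability of `σ` for the (negative) energy function `H`. -/
noncomputable def gibbs {n : ℕ} (H : Config n → ℝ) (σ : Config n) : ℝ :=
  Real.exp (H σ) / ∑ τ : Config n, Real.exp (H τ)

/-- Exponent of the null model in the outer field `h`: no interaction between the spins. -/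
noncomputable def nullEnergy {n : ℕ} (h : Fin n → ℝ) (σ : Config n) : ℝ :=
  ∑ i, h i * spin (σ i)

/-- Exponent of the planted model in the outer field `h`: a Curie--Weiss interaction of strength
`θ` on the hidden clique `S`. -/
noncomputable def plantedEnergy {n : ℕ} (θ : ℝ) (S : Finset (Fin n)) (h : Fin n → ℝ)
    (σ : Config n) : ℝ :=
  θ / (2 * (S.card : ℝ)) * (∑ i ∈ S, spin (σ i)) ^ 2 + ∑ i, h i * spin (σ i)

/-- The law of one observed configuration under the null hypothesis: the field has i.i.d.
coordinates with law `μ` and is not observed. -/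
noncomputable def nullProb (μ : Measure ℝ) {n : ℕ} (σ : Config n) : ℝ :=
  ∫ h : Fin n → ℝ, gibbs (nullEnergy h) σ ∂(Measure.pi fun _ => μ)

/-- The law of one observed configuration when the clique is `S`: the field has i.i.d.
coordinates with law `μ` and is not observed. -/
noncomputable def plantedProb (μ : Measure ℝ) (θ : ℝ) {n : ℕ} (S : Finset (Fin n))
    (σ : Config n) : ℝ :=
  ∫ h : Fin n → ℝ, gibbs (plantedEnergy θ S h) σ ∂(Measure.pi fun _ => μ)

/-- A (possibly randomized) test based on `m` configurations of `n` spins: the probability of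
rejecting the null hypothesis, as a function of the sample. -/
abbrev Test (n m : ℕ) : Type := (Fin m → Config n) → unitInterval

/-- Probability that `φ` rejects when the sample consists of `m` independent configurations,
each drawn from the null model (with its own independent field). -/
noncomputable def typeIError (μ : Measure ℝ) {n m : ℕ} (φ : Test n m) : ℝ :=
  ∑ x : Fin m → Config n, (∏ j, nullProb μ (x j)) * (φ x : ℝ)

/-- Probability that `φ` accepts when the sample consists of `m` independent configurations,
each drawn from the model with clique `S` (with its own independent field). -/
noncomputable def typeIIError (μ : Measure ℝ) (θ : ℝ) {n m : ℕ} (S : Finset (Fin n))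
    (φ : Test n m) : ℝ :=
  ∑ x : Fin m → Config n, (∏ j, plantedProb μ θ S (x j)) * (1 - (φ x : ℝ))

/-- Worst-case risk: type I error plus the largest type II error over all cliques of size `k`. -/
noncomputable def risk (μ : Measure ℝ) (θ : ℝ) {n m : ℕ} (k : ℕ) (φ : Test n m) : ℝ :=
  typeIError μ φ + ⨆ S : {S : Finset (Fin n) // S.card = k}, typeIIError μ θ S.1 φ

/-- Every sequence of tests is asymptotically powerless: its worst-case risk has lower limit
at least `1`, the risk of a test that ignores the data. -/
def AllTestsPowerless (μ : Measure ℝ) (θ : ℝ) (k m : ℕ → ℕ) : Prop :=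
  ∀ φ : (n : ℕ) → Test n (m n), ∀ ε : ℝ, 0 < ε →
    ∀ᶠ n in atTop, 1 - ε ≤ risk μ θ (k n) (φ n)

/-- `E[sech² h]` for `h` with law `μ`. -/
noncomputable def meanSechSq (μ : Measure ℝ) : ℝ := ∫ h, (1 / Real.cosh h) ^ 2 ∂μ

/-- The mean-field potential `x² / 2 - E[log cosh (√θ x + h)]`, normalized to vanish at `0` by
adding `E[log cosh h]` under the expectation (so that it is finite for every law `μ`). -/
noncomputable def potential (μ : Measure ℝ) (θ x : ℝ) : ℝ :=
  x ^ 2 / 2 - ∫ h, (Real.log (Real.cosh (Real.sqrt θ * x + h)) - Real.log (Real.cosh h)) ∂μ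

/-- The high-temperature regime: `0 < θ < 1 / E[sech² h]`, and `0` is the unique global minimizer
of the mean-field potential. -/
def HighTemperature (μ : Measure ℝ) (θ : ℝ) : Prop :=
  0 < θ ∧ θ < 1 / meanSechSq μ ∧ ∀ x : ℝ, x ≠ 0 → potential μ θ 0 < potential μ θ x

end PlantedRFCW

/-!
The proof is a second moment argument for the uniform mixture of the planted sample laws over `S`.
Since the law of the field is symmetric, the null law is uniform, and by Parseval the correlation
of the likelihood ratios of two planted laws is a sum over the subsets of `S ∩ S'` of products of
Walsh coefficients. By exchangeability inside `S` such a coefficient depends only on the order `a`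
of the subset; the coefficient of order `0` is `1` and the global spin flip removes the odd orders,
so the first contribution has order `2`. As `choose r a ≤ (r / k) ^ a * choose k a`, an overlap
`r ≤ ρ² k` has correlation `1 + O((r / k)²)` once the Walsh coefficients of the planted law, damped
by `ρ ^ a`, are square summable uniformly in `k`. This is hypercontractivity of the noise operator,
fed with a uniform bound on `E exp (c M_S² / k)` for the magnetization `M_S`. That bound is where
high temperature enters: the Hubbard--Stratonovich transform turns the partition function into a
Gaussian integral of products of `cosh`, whose exponent is controlled for typical fields by the
mean-field potential.

For overlaps comparable to `k` the correlation need not be close to `1`, so the planted laws are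
first restricted to samples with total squared magnetization `O(k m)`, an event which the same
exponential moment makes typical. The overlap with a uniform subset has Poisson-type tails around
`k² / n`: the small overlaps contribute `1 + o(1)` because `m = o(n² / k²)`, and the large ones are
negligible because `m = o(k log (n / k))`.
-/


namespace PlantedRFCW

/-! ### Spins and Gibbs measures -/

lemma spin_one : spin 1 = 1 := by simp [spin]

lemma spin_neg (s : ℤˣ) : spin (-s) = -spin s := by simp [spin]

lemma spin_mul (s t : ℤˣ) : spin (s * t) = spin s * spin t := by simp [spin]

lemma spin_eq_or (s : ℤˣ) : spin s = 1 ∨ spin s = -1 := by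
  rcases Int.units_eq_one_or s with rfl | rfl <;> simp [spin]

lemma spin_mul_self (s : ℤˣ) : spin s * spin s = 1 := by
  rcases spin_eq_or s with h | h <;> rw [h] <;> norm_num

lemma abs_spin (s : ℤˣ) : |spin s| = 1 := by
  rcases spin_eq_or s with h | h <;> rw [h] <;> norm_num

lemma sum_units_int (f : ℤˣ → ℝ) : ∑ s : ℤˣ, f s = f 1 + f (-1) := by
  rw [UnitsInt.univ]
  exact Finset.sum_pair (by decide)

lemma sum_config_prod {n : ℕ} (f : Fin n → ℤˣ → ℝ) :
    ∑ σ : Config n, ∏ i, f i (σ i) = ∏ i, (f i 1 + f i (-1)) := by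
  simp_rw [← sum_units_int, Finset.prod_univ_sum, Fintype.piFinset_univ]

lemma card_config (n : ℕ) : Fintype.card (Config n) = 2 ^ n := by
  simp [Config]

/-- The expectation of the observable `G` under the Gibbs measure of energy `H`. -/
noncomputable def gibbsMean {n : ℕ} (H G : Config n → ℝ) : ℝ := ∑ σ, gibbs H σ * G σ

section Gibbs

variable {n : ℕ} (H : Config n → ℝ) (σ : Config n)

lemma sum_exp_pos : 0 < ∑ τ : Config n, Real.exp (H τ) :=
  Finset.sum_pos (fun _ _ => Real.exp_pos _) Finset.univ_nonempty

lemma gibbs_nonneg : 0 ≤ gibbs H σ := div_nonneg (Real.exp_pos _).le (sum_exp_pos H).le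

lemma sum_gibbs : ∑ σ : Config n, gibbs H σ = 1 := by
  unfold gibbs
  rw [← Finset.sum_div, div_self (sum_exp_pos H).ne']

lemma gibbs_le_one : gibbs H σ ≤ 1 := by
  rw [← sum_gibbs H]
  exact Finset.single_le_sum (fun τ _ => gibbs_nonneg H τ) (Finset.mem_univ σ)

lemma gibbsMean_const (c : ℝ) : gibbsMean H (fun _ => c) = c := by
  rw [gibbsMean, ← Finset.sum_mul, sum_gibbs, one_mul]

variable {H} in
lemma gibbsMean_mono {G G' : Config n → ℝ} (h : ∀ σ, G σ ≤ G' σ) :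
    gibbsMean H G ≤ gibbsMean H G' :=
  Finset.sum_le_sum fun σ _ => mul_le_mul_of_nonneg_left (h σ) (gibbs_nonneg H σ)

variable {H} in
lemma gibbsMean_nonneg {G : Config n → ℝ} (h : ∀ σ, 0 ≤ G σ) : 0 ≤ gibbsMean H G :=
  Finset.sum_nonneg fun σ _ => mul_nonneg (gibbs_nonneg H σ) (h σ)

lemma gibbs_congr_equiv {m : ℕ} (H' : Config m → ℝ) (e : Config n ≃ Config m)
    (h : ∀ τ, H' (e τ) = H τ) : gibbs H' (e σ) = gibbs H σ := by
  unfold gibbs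
  rw [h, ← e.sum_comp]
  simp_rw [h]

lemma gibbs_add (G : Config n → ℝ) :
    gibbs (fun τ => G τ + H τ) σ =
      gibbs H σ * Real.exp (G σ) / gibbsMean H fun τ => Real.exp (G τ) := by
  have partition_eq : (gibbsMean H fun τ => Real.exp (G τ)) =
      (∑ τ, Real.exp (G τ + H τ)) / ∑ τ, Real.exp (H τ) := by
    rw [gibbsMean, Finset.sum_div]
    refine Finset.sum_congr rfl fun τ _ => ?_
    rw [gibbs, Real.exp_add]
    ring
  have := (sum_exp_pos H).ne'
  have := (sum_exp_pos fun τ => G τ + H τ).ne'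
  rw [partition_eq, gibbs, gibbs, Real.exp_add]
  field_simp

end Gibbs

/-- The magnetization of `σ` on the set `S`. -/
noncomputable def mag {n : ℕ} (S : Finset (Fin n)) (σ : Config n) : ℝ := ∑ i ∈ S, spin (σ i)

section Energies

variable {n : ℕ} (S : Finset (Fin n)) (h : Fin n → ℝ) (σ : Config n)

lemma mag_sq_le : mag S σ ^ 2 ≤ (S.card : ℝ) ^ 2 := by
  rw [sq_le_sq, abs_of_nonneg (Nat.cast_nonneg (α := ℝ) S.card)]
  refine (Finset.abs_sum_le_sum_abs _ _).trans ?_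
  simp [abs_spin]

lemma plantedEnergy_zero : plantedEnergy 0 S h = nullEnergy h := by
  ext τ
  simp [plantedEnergy, nullEnergy]

lemma gibbs_nullEnergy :
    gibbs (nullEnergy h) σ = ∏ i, (Real.exp (h i * spin (σ i)) / (2 * Real.cosh (h i))) := by
  rw [gibbs, Finset.prod_div_distrib]
  simp_rw [nullEnergy, Real.exp_sum]
  rw [sum_config_prod (fun i s => Real.exp (h i * spin s))]
  congr 1
  refine Finset.prod_congr rfl fun i _ => ?_
  rw [spin_neg, spin_one, Real.cosh_eq]
  ring_nf

lemma gibbs_nullEnergy_zero : gibbs (nullEnergy fun _ => 0) σ = ((2 : ℝ) ^ n)⁻¹ := by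
  simp [gibbs_nullEnergy]

lemma gibbs_plantedEnergy_le {θ : ℝ} (hθ : 0 ≤ θ) :
    gibbs (plantedEnergy θ S h) σ ≤
      gibbs (nullEnergy h) σ * Real.exp (θ / (2 * (S.card : ℝ)) * mag S σ ^ 2) := by
  have one_le_partition :
      1 ≤ gibbsMean (nullEnergy h) fun τ => Real.exp (θ / (2 * (S.card : ℝ)) * mag S τ ^ 2) := by
    rw [← gibbsMean_const (nullEnergy h) 1]
    exact gibbsMean_mono fun τ => Real.one_le_exp (by positivity)
  exact (gibbs_add (nullEnergy h) σ fun τ => θ / (2 * (S.card : ℝ)) * mag S τ ^ 2).trans_le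
    (div_le_self (mul_nonneg (gibbs_nonneg _ _) (Real.exp_pos _).le) one_le_partition)

end Energies

/-! ### Averaging over the field -/

section Field

variable (μ : Measure ℝ) {n : ℕ} (θ : ℝ) (S : Finset (Fin n))

lemma plantedProb_nonneg (σ : Config n) : 0 ≤ plantedProb μ θ S σ :=
  integral_nonneg fun _ => gibbs_nonneg _ _

lemma plantedProb_zero (σ : Config n) : plantedProb μ 0 S σ = nullProb μ σ := by
  simp only [plantedProb, nullProb, plantedEnergy_zero]

lemma measurable_gibbs_plantedEnergy (σ : Config n) :
    Measurable fun h : Fin n → ℝ => gibbs (plantedEnergy θ S h) σ := by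
  unfold gibbs plantedEnergy
  fun_prop

variable [IsProbabilityMeasure μ]

lemma integrable_gibbs_plantedEnergy (σ : Config n) :
    Integrable (fun h : Fin n → ℝ => gibbs (plantedEnergy θ S h) σ) (Measure.pi fun _ => μ) :=
  Integrable.of_bound (measurable_gibbs_plantedEnergy θ S σ).aestronglyMeasurable 1
    (ae_of_all _ fun h => by
      rw [Real.norm_of_nonneg (gibbs_nonneg _ _)]
      exact gibbs_le_one _ _)

lemma integrable_gibbsMean_plantedEnergy (G : Config n → ℝ) :
    Integrable (fun h : Fin n → ℝ => gibbsMean (plantedEnergy θ S h) G) (Measure.pi fun _ => μ) :=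
  integrable_finsetSum _ fun σ _ => (integrable_gibbs_plantedEnergy μ θ S σ).mul_const _

lemma sum_plantedProb_mul (G : Config n → ℝ) :
    ∑ σ, plantedProb μ θ S σ * G σ =
      ∫ h : Fin n → ℝ, gibbsMean (plantedEnergy θ S h) G ∂(Measure.pi fun _ => μ) := by
  simp_rw [gibbsMean]
  rw [integral_finsetSum _ fun σ _ => (integrable_gibbs_plantedEnergy μ θ S σ).mul_const _]
  simp_rw [integral_mul_const]
  rfl

lemma sum_plantedProb : ∑ σ, plantedProb μ θ S σ = 1 := by
  simpa [gibbsMean_const] using sum_plantedProb_mul μ θ S fun _ => 1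

/-! ### Symmetries -/

lemma plantedProb_map (π : Equiv.Perm (Fin n)) (σ : Config n) :
    plantedProb μ θ (S.map π.toEmbedding) σ = plantedProb μ θ S (σ ∘ π) := by
  unfold plantedProb
  have hp := measurePreserving_piCongrLeft (fun _ : Fin n => μ) π
  rw [← hp.integral_comp' (fun h => gibbs (plantedEnergy θ (S.map π.toEmbedding) h) σ)]
  refine integral_congr_ae (ae_of_all _ fun h => ?_)
  have relabel := gibbs_congr_equiv (plantedEnergy θ S h) (σ ∘ π)
    (plantedEnergy θ (S.map π.toEmbedding) (MeasurableEquiv.piCongrLeft (fun _ : Fin n => ℝ) π h))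
    (Equiv.arrowCongr π (Equiv.refl _)) (fun τ => ?_)
  · convert relabel using 2
    ext i
    simp [Equiv.arrowCongr]
  · unfold plantedEnergy
    rw [Finset.card_map, Finset.sum_map]
    congr 1
    · simp [Equiv.arrowCongr]
    · rw [← Equiv.sum_comp π]
      refine Finset.sum_congr rfl fun i _ => ?_
      congr 1
      · exact MeasurableEquiv.piCongrLeft_apply_apply (β := fun _ => ℝ) π h i
      · simp [Equiv.arrowCongr]

lemma measurePreserving_spin_mul [μ.IsNegInvariant] (ε : Config n) :
    MeasurePreserving (fun (h : Fin n → ℝ) i => spin (ε i) * h i)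
      (Measure.pi fun _ => μ) (Measure.pi fun _ => μ) := by
  refine measurePreserving_pi (fun _ => μ) (fun _ => μ) (f := fun i x => spin (ε i) * x)
    fun i => ?_
  rcases spin_eq_or (ε i) with h | h <;> simp only [h]
  · simp only [one_mul]
    exact MeasurePreserving.id μ
  · simpa only [neg_one_mul] using Measure.measurePreserving_neg μ

lemma nullEnergy_spin_mul (ε : Config n) (h : Fin n → ℝ) (σ : Config n) :
    nullEnergy (fun i => spin (ε i) * h i) (ε * σ) = nullEnergy h σ := by
  refine Finset.sum_congr rfl fun i _ => ?_
  rw [Pi.mul_apply, spin_mul]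
  linear_combination h i * spin (σ i) * spin_mul_self (ε i)

variable {S} in
lemma plantedProb_mul_left [μ.IsNegInvariant] {ε : Config n}
    (hε : ∀ τ, mag S (ε * τ) ^ 2 = mag S τ ^ 2) (σ : Config n) :
    plantedProb μ θ S (ε * σ) = plantedProb μ θ S σ := by
  have hflip := measurePreserving_spin_mul μ ε
  have hmeas := measurable_gibbs_plantedEnergy θ S (ε * σ)
  unfold plantedProb
  conv_lhs => rw [← hflip.map_eq]
  rw [integral_map hflip.measurable.aemeasurable hmeas.aestronglyMeasurable]
  refine integral_congr_ae (ae_of_all _ fun h => ?_)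
  refine gibbs_congr_equiv (plantedEnergy θ S h) σ _ (Equiv.mulLeft ε) fun τ => ?_
  change _ * mag S (ε * τ) ^ 2 + nullEnergy _ (ε * τ) = _ * mag S τ ^ 2 + nullEnergy h τ
  rw [hε, nullEnergy_spin_mul]

lemma nullProb_eq [μ.IsNegInvariant] (σ : Config n) : nullProb μ σ = ((2 : ℝ) ^ n)⁻¹ := by
  have invariant : ∀ τ : Config n, nullProb μ τ = nullProb μ σ := fun τ => by
    simpa [plantedProb_zero] using
      (plantedProb_mul_left μ 0 (S := ∅) (ε := σ * τ⁻¹) (by simp [mag]) τ).symm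
  have total := sum_plantedProb μ 0 (∅ : Finset (Fin n))
  simp_rw [plantedProb_zero, invariant] at total
  rw [Finset.sum_const, Finset.card_univ, card_config, nsmul_eq_mul] at total
  push_cast at total
  exact eq_inv_of_mul_eq_one_right total

end Field

/-! ### Estimates for `log cosh` -/

/-- The remainder of the first-order expansion at `h` of `log cosh`, for the increment `y`. -/
noncomputable def logCoshRem (y h : ℝ) : ℝ :=
  Real.log (Real.cosh (y + h)) - Real.log (Real.cosh h) - y * Real.tanh h

lemma hasDerivAt_log_cosh (x : ℝ) :
    HasDerivAt (fun x => Real.log (Real.cosh x)) (Real.tanh x) x := by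
  rw [Real.tanh_eq_sinh_div_cosh]
  exact (Real.hasDerivAt_cosh x).log (Real.cosh_pos x).ne'

lemma sech_sq_eq (x : ℝ) : (1 / Real.cosh x) ^ 2 = 1 - Real.tanh x ^ 2 := by
  rw [Real.tanh_eq_sinh_div_cosh]
  have := Real.cosh_sq x
  have := (Real.cosh_pos x).ne'
  field_simp
  linarith

lemma sech_sq_le_one (x : ℝ) : (1 / Real.cosh x) ^ 2 ≤ 1 := by
  linarith [sech_sq_eq x, sq_nonneg (Real.tanh x)]

lemma hasDerivAt_tanh (x : ℝ) : HasDerivAt Real.tanh ((1 / Real.cosh x) ^ 2) x := by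
  have hquot := (Real.hasDerivAt_sinh x).div (Real.hasDerivAt_cosh x) (Real.cosh_pos x).ne'
  rw [funext Real.tanh_eq_sinh_div_cosh]
  refine hquot.congr_deriv ?_
  have := Real.cosh_sq x
  have := (Real.cosh_pos x).ne'
  field_simp
  linarith

lemma measurable_tanh : Measurable Real.tanh :=
  (continuous_iff_continuousAt.2 fun x => (hasDerivAt_tanh x).continuousAt).measurable

lemma abs_tanh_le_one (x : ℝ) : |Real.tanh x| ≤ 1 := (Real.abs_tanh_lt_one x).le

lemma abs_tanh_sub_le (x y : ℝ) : |Real.tanh x - Real.tanh y| ≤ |x - y| := by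
  simpa using Convex.norm_image_sub_le_of_norm_hasDerivWithin_le (f := Real.tanh)
    (f' := fun x => (1 / Real.cosh x) ^ 2) (s := Set.univ) (C := 1) (x := y) (y := x)
    (fun z _ => (hasDerivAt_tanh z).hasDerivWithinAt)
    (fun z _ => by
      rw [Real.norm_of_nonneg (by positivity)]
      exact sech_sq_le_one z)
    convex_univ (Set.mem_univ _) (Set.mem_univ _)

lemma sech_sq_le_add (x y : ℝ) :
    (1 / Real.cosh x) ^ 2 ≤ (1 / Real.cosh y) ^ 2 + 2 * |x - y| := by
  have tanh_add_le : |Real.tanh y + Real.tanh x| ≤ 2 :=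
    (abs_add_le _ _).trans (by linarith [abs_tanh_le_one x, abs_tanh_le_one y])
  have hsq : |Real.tanh y ^ 2 - Real.tanh x ^ 2| ≤ 2 * |x - y| := by
    rw [sq_sub_sq, abs_mul, abs_sub_comm x]
    exact mul_le_mul tanh_add_le (abs_tanh_sub_le y x) (abs_nonneg _) zero_le_two
  rw [sech_sq_eq, sech_sq_eq]
  linarith [(abs_le.1 hsq).2]

lemma tanh_add_sub_tanh_le {y z : ℝ} (h : ℝ) (hz : 0 ≤ z) (hzy : z ≤ y) :
    Real.tanh (z + h) - Real.tanh h ≤ ((1 / Real.cosh h) ^ 2 + 2 * y) * z := by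
  have mean_value := Convex.norm_image_sub_le_of_norm_hasDerivWithin_le (f := Real.tanh)
    (f' := fun x => (1 / Real.cosh x) ^ 2) (s := Set.Icc h (z + h))
    (C := (1 / Real.cosh h) ^ 2 + 2 * y) (x := h) (y := z + h)
    (fun w _ => (hasDerivAt_tanh w).hasDerivWithinAt)
    (fun w hw => by
      rw [Real.norm_of_nonneg (by positivity)]
      refine (sech_sq_le_add w h).trans ?_
      rw [abs_of_nonneg (by linarith [hw.1])]
      linarith [hw.2])
    (convex_Icc _ _) ⟨le_rfl, by linarith⟩ ⟨by linarith, le_rfl⟩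
  rw [add_sub_cancel_right, Real.norm_of_nonneg hz] at mean_value
  exact (le_abs_self _).trans mean_value

lemma logCoshRem_zero_left (h : ℝ) : logCoshRem 0 h = 0 := by simp [logCoshRem]

lemma logCoshRem_neg_neg (y h : ℝ) : logCoshRem (-y) (-h) = logCoshRem y h := by
  unfold logCoshRem
  rw [← neg_add, Real.cosh_neg, Real.cosh_neg, Real.tanh_neg]
  ring

lemma hasDerivAt_logCoshRem (y h : ℝ) :
    HasDerivAt (fun y => logCoshRem y h) (Real.tanh (y + h) - Real.tanh h) y := by
  unfold logCoshRem
  have hlog := (hasDerivAt_log_cosh (y + h)).comp_add_const y h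
  exact ((hlog.sub_const (Real.log (Real.cosh h))).sub
    ((hasDerivAt_id y).mul_const (Real.tanh h))).congr_deriv (by simp)

lemma measurable_logCoshRem (y : ℝ) : Measurable (logCoshRem y) := by
  unfold logCoshRem
  have := measurable_tanh
  fun_prop

lemma abs_logCoshRem_sub_le (x y h : ℝ) :
    |logCoshRem x h - logCoshRem y h| ≤ 2 * |x - y| := by
  simpa using Convex.norm_image_sub_le_of_norm_hasDerivWithin_le (f := fun y => logCoshRem y h)
    (f' := fun y => Real.tanh (y + h) - Real.tanh h) (s := Set.univ) (C := 2) (x := y) (y := x)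
    (fun z _ => (hasDerivAt_logCoshRem z h).hasDerivWithinAt)
    (fun z _ => (abs_sub _ _).trans (by linarith [abs_tanh_le_one (z + h), abs_tanh_le_one h]))
    convex_univ (Set.mem_univ _) (Set.mem_univ _)

lemma abs_logCoshRem_le (y h : ℝ) : |logCoshRem y h| ≤ 2 * |y| := by
  simpa [logCoshRem_zero_left] using abs_logCoshRem_sub_le y 0 h

lemma logCoshRem_le_of_nonneg {y : ℝ} (h : ℝ) (hy : 0 ≤ y) :
    logCoshRem y h ≤ ((1 / Real.cosh h) ^ 2 + 2 * y) * y ^ 2 / 2 := by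
  set a := (1 / Real.cosh h) ^ 2 + 2 * y
  have hderiv : ∀ z, HasDerivAt (fun z => logCoshRem z h - a * z ^ 2 / 2)
      (Real.tanh (z + h) - Real.tanh h - a * z) z := fun z => by
    refine ((hasDerivAt_logCoshRem z h).sub
      (((hasDerivAt_pow 2 z).const_mul a).div_const 2)).congr_deriv ?_
    push_cast
    ring
  have hanti : AntitoneOn (fun z => logCoshRem z h - a * z ^ 2 / 2) (Set.Icc 0 y) := by
    refine antitoneOn_of_deriv_nonpos (convex_Icc 0 y)
      (fun z _ => (hderiv z).continuousAt.continuousWithinAt)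
      (fun z _ => (hderiv z).differentiableAt.differentiableWithinAt) fun z hz => ?_
    rw [interior_Icc] at hz
    rw [(hderiv z).deriv]
    linarith [tanh_add_sub_tanh_le h hz.1.le hz.2.le]
  have := hanti ⟨le_rfl, hy⟩ ⟨hy, le_rfl⟩ hy
  simp only [logCoshRem_zero_left] at this
  linarith

lemma logCoshRem_le (y h : ℝ) :
    logCoshRem y h ≤ ((1 / Real.cosh h) ^ 2 + 2 * |y|) * y ^ 2 / 2 := by
  rcases le_total 0 y with hy | hy
  · rw [abs_of_nonneg hy]
    exact logCoshRem_le_of_nonneg h hy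
  · have := logCoshRem_le_of_nonneg (-h) (neg_nonneg.2 hy)
    rw [logCoshRem_neg_neg, Real.cosh_neg, neg_sq] at this
    rwa [abs_of_nonpos hy]

lemma logCoshRem_zero_right_le (y : ℝ) : logCoshRem y 0 ≤ y ^ 2 / 2 := by
  have : Real.log (Real.cosh y) ≤ y ^ 2 / 2 :=
    (Real.log_le_iff_le_exp (Real.cosh_pos y)).2 (Real.cosh_le_exp_half_sq y)
  simpa [logCoshRem] using this

lemma exp_logCoshRem_add (y h : ℝ) :
    Real.exp (logCoshRem y h + y * Real.tanh h) = Real.cosh (y + h) / Real.cosh h := by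
  rw [logCoshRem, sub_add_cancel, Real.exp_sub, Real.exp_log (Real.cosh_pos _),
    Real.exp_log (Real.cosh_pos _)]

/-! ### The mean-field potential and typical fields -/

open ProbabilityTheory in
lemma measureReal_pi_le_sum_le {Ω ι : Type*} [MeasurableSpace Ω] [Fintype ι] (μ : Measure Ω)
    [IsProbabilityMeasure μ] {g : Ω → ℝ} (hg : Measurable g) {b : ℝ} (hb : 0 < b)
    (hgb : ∀ x, |g x| ≤ b) {a : ℝ} (ha : ∫ x, g x ∂μ ≤ a) (S : Finset ι) :
    (Measure.pi fun _ : ι => μ).real {h | a * S.card ≤ ∑ i ∈ S, g (h i)} ≤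
      Real.exp (-((a - ∫ x, g x ∂μ) ^ 2 / (2 * b ^ 2) * S.card)) := by
  set e := ∫ x, g x ∂μ
  have hmean : ∀ i : ι, ∫ h : ι → Ω, g (h i) ∂(Measure.pi fun _ => μ) = e := fun _ =>
    integral_comp_eval (μ := fun _ : ι => μ) hg.aestronglyMeasurable
  have hindep : iIndepFun (fun (i : ι) (h : ι → Ω) => g (h i) - e) (Measure.pi fun _ => μ) :=
    iIndepFun_pi (μ := fun _ : ι => μ) (X := fun _ x => g x - e)
      fun _ => (hg.sub_const e).aemeasurable
  have hsub : ∀ i ∈ S, HasSubgaussianMGF (fun h : ι → Ω => g (h i) - e)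
      ((‖b - -b‖₊ / 2) ^ 2) (Measure.pi fun _ => μ) := fun i _ => by
    rw [← hmean i]
    exact hasSubgaussianMGF_of_mem_Icc
      (hg.comp (measurable_pi_apply i)).aemeasurable (ae_of_all _ fun h => abs_le.1 (hgb (h i)))
  have hoeffding := HasSubgaussianMGF.measure_sum_ge_le_of_iIndepFun hindep hsub
    (ε := (a - e) * S.card) (mul_nonneg (sub_nonneg.2 ha) (Nat.cast_nonneg _))
  refine le_trans (le_of_eq ?_) (hoeffding.trans (Real.exp_le_exp.2 (le_of_eq ?_)))
  · congr 1
    ext h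
    simp only [Set.mem_ofPred_eq, Finset.sum_sub_distrib, Finset.sum_const, nsmul_eq_mul]
    constructor <;> intro H <;> linarith
  · have width : ‖b - -b‖ = 2 * b := by
      rw [Real.norm_of_nonneg (by linarith)]
      ring
    rw [Finset.sum_const, nsmul_eq_mul]
    push_cast
    rw [width]
    rcases Nat.eq_zero_or_pos S.card with h0 | h0
    · simp [h0]
    · have : (S.card : ℝ) ≠ 0 := by positivity
      field_simp

lemma exists_lt_one_sub_mul {a b : ℝ} (hab : a < b) : ∃ δ > 0, δ < 1 ∧ a < (1 - δ) * b := by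
  have hlim : Tendsto (fun δ : ℝ => (1 - δ) * b) (nhdsWithin 0 (Set.Ioi 0)) (nhds ((1 - 0) * b)) :=
    tendsto_nhdsWithin_of_tendsto_nhds (Continuous.tendsto (by fun_prop) _)
  obtain ⟨δ, hδa, hδ⟩ := ((hlim.eventually (lt_mem_nhds (by simpa using hab))).and
    (Ioo_mem_nhdsGT (zero_lt_one' ℝ))).exists
  exact ⟨δ, hδ.1, hδ.2, hδa⟩

/-- Outside a set of fields of exponentially small probability, the remainder of `log cosh`
summed over the clique stays below `(1 - δ) y² / (2θ)` per site, for all increments `y` in `s`.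
The constants depend neither on the dimension nor on the clique. -/
def RemControlled (μ : Measure ℝ) (θ : ℝ) (s : Set ℝ) : Prop :=
  ∃ δ > 0, δ < 1 ∧ ∃ c > 0, ∃ C > 0, ∀ (n : ℕ) (S : Finset (Fin n)), ∃ B : Set (Fin n → ℝ),
    MeasurableSet B ∧
    (Measure.pi fun _ : Fin n => μ).real B ≤ C * Real.exp (-(c * S.card)) ∧
    ∀ h ∉ B, ∀ y ∈ s, ∑ i ∈ S, logCoshRem y (h i) ≤ S.card * ((1 - δ) * y ^ 2 / (2 * θ))

section RemControlled

variable {μ : Measure ℝ} {θ : ℝ}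

lemma RemControlled.mono {s t : Set ℝ} (hst : s ⊆ t) (ht : RemControlled μ θ t) :
    RemControlled μ θ s := by
  obtain ⟨δ, hδ0, hδ1, c, hc, C, hC, H⟩ := ht
  refine ⟨δ, hδ0, hδ1, c, hc, C, hC, fun n S => ?_⟩
  obtain ⟨B, hBm, hBp, hB⟩ := H n S
  exact ⟨B, hBm, hBp, fun h hh y hy => hB h hh y (hst hy)⟩

lemma RemControlled.union (hθ : 0 < θ) {s t : Set ℝ} (hs : RemControlled μ θ s)
    (ht : RemControlled μ θ t) : RemControlled μ θ (s ∪ t) := by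
  obtain ⟨δ, hδ0, hδ1, c, hc, C, hC, H⟩ := hs
  obtain ⟨δ', hδ0', -, c', hc', C', hC', H'⟩ := ht
  refine ⟨min δ δ', lt_min hδ0 hδ0', (min_le_left _ _).trans_lt hδ1, min c c', lt_min hc hc',
    C + C', by positivity, fun n S => ?_⟩
  obtain ⟨B, hBm, hBp, hB⟩ := H n S
  obtain ⟨B', hBm', hBp', hB'⟩ := H' n S
  have parabola_mono : ∀ {d : ℝ} (y : ℝ), min δ δ' ≤ d →
      (S.card : ℝ) * ((1 - d) * y ^ 2 / (2 * θ)) ≤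
        S.card * ((1 - min δ δ') * y ^ 2 / (2 * θ)) := fun y hd => by gcongr
  refine ⟨B ∪ B', hBm.union hBm', ?_, fun h hh y hy => ?_⟩
  · refine (measureReal_union_le _ _).trans ?_
    rw [add_mul]
    refine add_le_add (hBp.trans ?_) (hBp'.trans ?_)
    · gcongr
      exact min_le_left _ _
    · gcongr
      exact min_le_right _ _
  · rw [Set.mem_union, not_or] at hh
    rcases hy with hy | hy
    · exact (hB h hh.1 y hy).trans (parabola_mono y (min_le_left _ _))
    · exact (hB' h hh.2 y hy).trans (parabola_mono y (min_le_right _ _))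

lemma remControlled_of_affine_bound [IsProbabilityMeasure μ] {g : ℝ → ℝ} (hg : Measurable g)
    {b : ℝ} (hb : 0 < b) (hgb : ∀ x, |g x| ≤ b) {a : ℝ} (ha : ∫ x, g x ∂μ < a)
    {δ : ℝ} (hδ0 : 0 < δ) (hδ1 : δ < 1) {s : Set ℝ} (u v : ℝ → ℝ) (hu : ∀ y ∈ s, 0 ≤ u y)
    (hrem : ∀ y ∈ s, ∀ h, logCoshRem y h ≤ u y * g h + v y)
    (hparabola : ∀ y ∈ s, u y * a + v y ≤ (1 - δ) * y ^ 2 / (2 * θ)) :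
    RemControlled μ θ s := by
  have := sub_pos.2 ha
  refine ⟨δ, hδ0, hδ1, (a - ∫ x, g x ∂μ) ^ 2 / (2 * b ^ 2), by positivity, 1, one_pos, fun n S =>
    ⟨{h | a * S.card ≤ ∑ i ∈ S, g (h i)}, ?_, ?_, fun h hh y hy => ?_⟩⟩
  · refine measurableSet_le measurable_const (Finset.measurable_fun_sum _ fun i _ => ?_)
    exact hg.comp (measurable_pi_apply i)
  · rw [one_mul]
    exact measureReal_pi_le_sum_le μ hg hb hgb ha.le S
  · have hsum : ∑ i ∈ S, g (h i) ≤ a * S.card := (not_le.1 hh).le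
    calc ∑ i ∈ S, logCoshRem y (h i) ≤ ∑ i ∈ S, (u y * g (h i) + v y) :=
          Finset.sum_le_sum fun i _ => hrem y hy (h i)
      _ = u y * ∑ i ∈ S, g (h i) + S.card * v y := by
          rw [Finset.sum_add_distrib, ← Finset.mul_sum, Finset.sum_const, nsmul_eq_mul]
      _ ≤ u y * (a * S.card) + S.card * v y := by gcongr; exact hu y hy
      _ = S.card * (u y * a + v y) := by ring
      _ ≤ S.card * ((1 - δ) * y ^ 2 / (2 * θ)) := by gcongr; exact hparabola y hy

lemma remControlled_nhds_of_integral_lt [IsProbabilityMeasure μ] {x : ℝ} (hx : x ≠ 0)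
    (h : ∫ h, logCoshRem x h ∂μ < x ^ 2 / (2 * θ)) :
    ∃ t ∈ nhds x, RemControlled μ θ t := by
  obtain ⟨a, ha, hax⟩ := exists_between h
  obtain ⟨δ, hδ0, hδ1, hδ⟩ := exists_lt_one_sub_mul hax
  have hnear : ∀ᶠ y in nhds x, a + 2 * |y - x| < (1 - δ) * y ^ 2 / (2 * θ) := by
    have hlim : Tendsto (fun y : ℝ => (1 - δ) * y ^ 2 / (2 * θ) - 2 * |y - x|) (nhds x)
        (nhds ((1 - δ) * x ^ 2 / (2 * θ) - 2 * |x - x|)) := Continuous.tendsto (by fun_prop) _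
    filter_upwards [hlim.eventually (lt_mem_nhds (a := a) (by simpa [mul_div_assoc] using hδ))]
      with y hy
    linarith
  refine ⟨_, hnear, remControlled_of_affine_bound (measurable_logCoshRem x) (b := 2 * |x|)
    (by positivity) (abs_logCoshRem_le x) ha hδ0 hδ1 (fun _ => 1) (fun y => 2 * |y - x|)
    (fun _ _ => zero_le_one) (fun y _ h => ?_) fun y hy => ?_⟩
  · linarith [(abs_le.1 (abs_logCoshRem_sub_le y x h)).2]
  · rw [one_mul]
    exact le_of_lt hy

lemma remControlled_nhds_zero [IsProbabilityMeasure μ] (h : meanSechSq μ < 1 / θ) :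
    ∃ t ∈ nhds (0 : ℝ), RemControlled μ θ t := by
  obtain ⟨a, ha, haθ⟩ := exists_between h
  obtain ⟨δ, hδ0, hδ1, hδ⟩ := exists_lt_one_sub_mul haθ
  have hnear : ∀ᶠ y in nhds (0 : ℝ), a + 2 * |y| < (1 - δ) * (1 / θ) := by
    have hlim : Tendsto (fun y : ℝ => a + 2 * |y|) (nhds 0) (nhds (a + 2 * |0|)) :=
      Continuous.tendsto (by fun_prop) _
    exact hlim.eventually (gt_mem_nhds (by simpa using hδ))
  refine ⟨_, hnear, remControlled_of_affine_bound (by fun_prop) one_pos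
    (fun x => by rw [abs_of_nonneg (by positivity)]; exact sech_sq_le_one x) ha hδ0 hδ1
    (fun y => y ^ 2 / 2) (fun y => 2 * |y| * (y ^ 2 / 2)) (fun y _ => by positivity)
    (fun y _ h => by linarith [logCoshRem_le y h]) fun y hy => ?_⟩
  have hy : a + 2 * |y| ≤ (1 - δ) * (1 / θ) := le_of_lt hy
  calc y ^ 2 / 2 * a + 2 * |y| * (y ^ 2 / 2) = y ^ 2 / 2 * (a + 2 * |y|) := by ring
    _ ≤ y ^ 2 / 2 * ((1 - δ) * (1 / θ)) := by gcongr
    _ = (1 - δ) * y ^ 2 / (2 * θ) := by field_simp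

lemma remControlled_of_large [IsProbabilityMeasure μ] (hθ : 0 < θ) :
    RemControlled μ θ {y : ℝ | 8 * θ ≤ |y|} := by
  refine remControlled_of_affine_bound measurable_const one_pos (g := fun _ => 0) (a := 1)
    (fun _ => by simp) (by simp) (δ := 1 / 2) (by norm_num) (by norm_num) (fun _ => 0)
    (fun y => 2 * |y|) (fun _ _ => le_rfl)
    (fun y _ h => by linarith [(abs_le.1 (abs_logCoshRem_le y h)).2]) fun y hy => ?_
  have hy : 8 * θ ≤ |y| := hy
  rw [zero_mul, zero_add, le_div_iff₀ (by positivity), ← sq_abs y]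
  nlinarith [abs_nonneg y]

end RemControlled

section HighTemperature

variable {μ : Measure ℝ} {θ : ℝ}

lemma integral_tanh_eq_zero [μ.IsNegInvariant] : ∫ h, Real.tanh h ∂μ = 0 := by
  have hneg := integral_neg_eq_self Real.tanh μ
  simp_rw [Real.tanh_neg, integral_neg] at hneg
  linarith

lemma integral_logCoshRem [IsProbabilityMeasure μ] [μ.IsNegInvariant] (y : ℝ) :
    ∫ h, logCoshRem y h ∂μ =
      ∫ h, (Real.log (Real.cosh (y + h)) - Real.log (Real.cosh h)) ∂μ := by
  have htanh : Integrable (fun h => y * Real.tanh h) μ :=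
    (Integrable.of_bound measurable_tanh.aestronglyMeasurable 1
      (ae_of_all _ abs_tanh_le_one)).const_mul y
  have hrem : Integrable (logCoshRem y) μ :=
    Integrable.of_bound (measurable_logCoshRem y).aestronglyMeasurable (2 * |y|)
      (ae_of_all _ (abs_logCoshRem_le y))
  have expansion : ∀ h, Real.log (Real.cosh (y + h)) - Real.log (Real.cosh h) =
      logCoshRem y h + y * Real.tanh h := fun h => by
    unfold logCoshRem
    ring
  simp_rw [expansion]
  rw [integral_add hrem htanh, integral_const_mul, integral_tanh_eq_zero, mul_zero, add_zero]

lemma HighTemperature.integral_logCoshRem_lt [IsProbabilityMeasure μ] [μ.IsNegInvariant]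
    (hθ : HighTemperature μ θ) {y : ℝ} (hy : y ≠ 0) :
    ∫ h, logCoshRem y h ∂μ < y ^ 2 / (2 * θ) := by
  obtain ⟨hθ0, -, hmin⟩ := hθ
  have hsqrt := (Real.sqrt_pos.2 hθ0).ne'
  have potential_pos := hmin (y / Real.sqrt θ) (div_ne_zero hy hsqrt)
  simp only [potential, mul_zero, zero_add, sub_self, integral_zero, mul_div_cancel₀ y hsqrt,
    ← integral_logCoshRem, div_pow, Real.sq_sqrt hθ0.le, ne_eq, OfNat.ofNat_ne_zero,
    not_false_eq_true, zero_pow, zero_div, div_div, mul_comm θ] at potential_pos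
  linarith

lemma HighTemperature.meanSechSq_lt (hθ : HighTemperature μ θ) : meanSechSq μ < 1 / θ := by
  obtain ⟨hθ0, hθ1, -⟩ := hθ
  have hpos : 0 < meanSechSq μ := one_div_pos.1 (hθ0.trans hθ1)
  rwa [lt_one_div hpos hθ0]

theorem HighTemperature.remControlled_univ [IsProbabilityMeasure μ] [μ.IsNegInvariant]
    (hθ : HighTemperature μ θ) : RemControlled μ θ Set.univ := by
  have hθ0 := hθ.1
  have controlled_nhds : ∀ x, ∃ t ∈ nhds x, RemControlled μ θ t := fun x => by
    rcases eq_or_ne x 0 with rfl | hx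
    · exact remControlled_nhds_zero hθ.meanSechSq_lt
    · exact remControlled_nhds_of_integral_lt hx (hθ.integral_logCoshRem_lt hx)
  have controlled_Icc : RemControlled μ θ (Set.Icc (-(8 * θ)) (8 * θ)) := by
    refine isCompact_Icc.induction_on ((remControlled_of_large hθ0).mono (Set.empty_subset _))
      (fun s t hst ht => ht.mono hst) (fun s t hs ht => hs.union hθ0 ht) fun x _ => ?_
    obtain ⟨t, ht, h⟩ := controlled_nhds x
    exact ⟨t, mem_nhdsWithin_of_mem_nhds ht, h⟩
  refine (controlled_Icc.union hθ0 (remControlled_of_large hθ0)).mono fun y _ => ?_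
  rcases le_total (8 * θ) |y| with h | h
  · exact Or.inr h
  · exact Or.inl (abs_le.1 h)

end HighTemperature

/-! ### Gaussian moments of the magnetization -/

lemma exp_neg_sq_add_eq {k : ℝ} (hk : 0 < k) (t x : ℝ) :
    Real.exp (-(k * x ^ 2 / 2) + t * x) =
      Real.exp (t ^ 2 / (2 * k)) * Real.exp (-(k / 2) * (x - t / k) ^ 2) := by
  rw [← Real.exp_add]
  congr 1
  field_simp
  ring

lemma integrable_exp_neg_sq_add {k : ℝ} (hk : 0 < k) (t : ℝ) :
    Integrable fun x : ℝ => Real.exp (-(k * x ^ 2 / 2) + t * x) := by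
  simp_rw [exp_neg_sq_add_eq hk]
  exact ((integrable_exp_neg_mul_sq (half_pos hk)).comp_sub_right (t / k)).const_mul _

lemma integral_exp_neg_sq_add {k : ℝ} (hk : 0 < k) (t : ℝ) :
    ∫ x : ℝ, Real.exp (-(k * x ^ 2 / 2) + t * x) =
      √(2 * Real.pi / k) * Real.exp (t ^ 2 / (2 * k)) := by
  simp_rw [exp_neg_sq_add_eq hk]
  rw [integral_const_mul, integral_sub_right_eq_self (fun x => Real.exp (-(k / 2) * x ^ 2)),
    integral_gaussian, mul_comm]
  congr 2
  field_simp

section GibbsMean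

variable {n : ℕ}

/-- The Hubbard--Stratonovich transform: a Gaussian average linearizes the square. -/
lemma integral_exp_neg_sq_mul_gibbsMean (H M : Config n → ℝ) {k : ℝ} (hk : 0 < k) (b : ℝ) :
    ∫ x : ℝ, Real.exp (-(k * x ^ 2 / 2)) * gibbsMean H (fun σ => Real.exp (b * x * M σ)) =
      √(2 * Real.pi / k) * gibbsMean H fun σ => Real.exp (b ^ 2 / (2 * k) * M σ ^ 2) := by
  have combine : ∀ (σ : Config n) (x : ℝ),
      Real.exp (-(k * x ^ 2 / 2)) * (gibbs H σ * Real.exp (b * x * M σ)) =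
        gibbs H σ * Real.exp (-(k * x ^ 2 / 2) + b * M σ * x) := fun σ x => by
    rw [Real.exp_add]
    ring_nf
  simp_rw [gibbsMean, Finset.mul_sum, combine]
  rw [integral_finsetSum _ fun σ _ => (integrable_exp_neg_sq_add hk _).const_mul _]
  refine Finset.sum_congr rfl fun σ _ => ?_
  rw [integral_const_mul, integral_exp_neg_sq_add hk, mul_pow]
  ring_nf

lemma gibbsMean_exp_mul_le_rpow (H G : Config n → ℝ) {s : ℝ} (hs0 : 0 < s) (hs1 : s ≤ 1) :
    gibbsMean H (fun σ => Real.exp (s * G σ)) ≤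
      gibbsMean H (fun σ => Real.exp (G σ)) ^ s := by
  have power_mean := Real.arith_mean_le_rpow_mean Finset.univ (gibbs H)
    (fun σ => Real.exp (s * G σ)) (fun σ _ => gibbs_nonneg _ σ) (sum_gibbs _)
    (fun σ _ => (Real.exp_pos _).le) (p := 1 / s) (by rw [le_div_iff₀ hs0]; linarith)
  have exponent : ∀ σ, s * G σ * (1 / s) = G σ := fun σ => by field_simp
  simpa only [gibbsMean, ← Real.exp_mul, one_div_one_div, exponent] using power_mean

lemma exp_mul_sq_gibbsMean_le (H M : Config n → ℝ) {c : ℝ} (hc : 0 ≤ c) :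
    Real.exp (c * gibbsMean H M ^ 2) ≤ gibbsMean H fun σ => Real.exp (c * M σ ^ 2) := by
  have weights_nonneg : ∀ σ ∈ (Finset.univ : Finset (Config n)), 0 ≤ gibbs H σ :=
    fun σ _ => gibbs_nonneg _ σ
  have jensen_exp := convexOn_exp.map_sum_le weights_nonneg (sum_gibbs H)
    (p := fun σ => c * M σ ^ 2) fun _ _ => Set.mem_univ _
  have jensen_sq := (even_two.convexOn_pow (𝕜 := ℝ)).map_sum_le weights_nonneg (sum_gibbs H)
    (p := M) fun _ _ => Set.mem_univ _
  simp only [smul_eq_mul] at jensen_exp jensen_sq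
  refine le_trans (Real.exp_le_exp.2 ?_) jensen_exp
  refine (mul_le_mul_of_nonneg_left jensen_sq hc).trans (le_of_eq ?_)
  rw [Finset.mul_sum]
  exact Finset.sum_congr rfl fun σ _ => by ring

lemma gibbsMean_exp_mag_sq_div_card_le (H : Config n → ℝ) (S : Finset (Fin n)) {c : ℝ}
    (hc : 0 ≤ c) :
    gibbsMean H (fun σ => Real.exp (c * (mag S σ ^ 2 / S.card))) ≤ Real.exp (c * S.card) := by
  rw [← gibbsMean_const H (Real.exp (c * S.card))]
  refine gibbsMean_mono fun σ => Real.exp_le_exp.2 (mul_le_mul_of_nonneg_left ?_ hc)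
  refine div_le_of_le_mul₀ (Nat.cast_nonneg _) (Nat.cast_nonneg _) ?_
  rw [← sq]
  exact mag_sq_le S σ

end GibbsMean

section NullField

variable {n : ℕ} (S : Finset (Fin n)) (h : Fin n → ℝ)

lemma gibbsMean_nullEnergy_exp_mag (y : ℝ) :
    gibbsMean (nullEnergy h) (fun σ => Real.exp (y * mag S σ)) =
      Real.exp (∑ i ∈ S, logCoshRem y (h i) + y * ∑ i ∈ S, Real.tanh (h i)) := by
  have factor : ∀ σ : Config n, gibbs (nullEnergy h) σ * Real.exp (y * mag S σ) =
      ∏ i, (Real.exp (h i * spin (σ i)) / (2 * Real.cosh (h i)) *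
        if i ∈ S then Real.exp (y * spin (σ i)) else 1) := fun σ => by
    rw [Finset.prod_mul_distrib, gibbs_nullEnergy, mag, Finset.mul_sum, Real.exp_sum,
      Finset.prod_ite_mem, Finset.univ_inter]
  have single_site : ∀ i, (Real.exp (h i * spin 1) / (2 * Real.cosh (h i)) *
        (if i ∈ S then Real.exp (y * spin 1) else 1) +
      Real.exp (h i * spin (-1)) / (2 * Real.cosh (h i)) *
        (if i ∈ S then Real.exp (y * spin (-1)) else 1)) =
      if i ∈ S then Real.exp (logCoshRem y (h i) + y * Real.tanh (h i)) else 1 := fun i => by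
    have := (Real.cosh_pos (h i)).ne'
    rw [spin_neg, spin_one, exp_logCoshRem_add]
    split_ifs
    · rw [Real.cosh_eq (y + h i), div_mul_eq_mul_div, div_mul_eq_mul_div, ← Real.exp_add,
        ← Real.exp_add, ← add_div, div_div, show h i * 1 + y * 1 = y + h i by ring,
        show h i * -1 + y * -1 = -(y + h i) by ring]
    · rw [mul_one, mul_one, mul_one, ← add_div, Real.cosh_eq, mul_neg_one]
      have := Real.exp_pos (h i)
      have := Real.exp_pos (-h i)
      field_simp
  simp_rw [gibbsMean, factor]
  rw [sum_config_prod (fun i s => Real.exp (h i * spin s) / (2 * Real.cosh (h i)) *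
        if i ∈ S then Real.exp (y * spin s) else 1)]
  simp_rw [single_site]
  rw [Finset.prod_ite_mem, Finset.univ_inter, ← Real.exp_sum, Finset.sum_add_distrib,
    ← Finset.mul_sum]

lemma gibbsMean_nullEnergy_mag :
    gibbsMean (nullEnergy h) (mag S) = ∑ i ∈ S, Real.tanh (h i) := by
  have deriv_mgf : HasDerivAt (fun y => gibbsMean (nullEnergy h) fun σ => Real.exp (y * mag S σ))
      (gibbsMean (nullEnergy h) (mag S)) 0 := by
    refine HasDerivAt.fun_sum fun σ _ => ?_
    simpa using (((hasDerivAt_id (0 : ℝ)).mul_const (mag S σ)).exp).const_mul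
      (gibbs (nullEnergy h) σ)
  have deriv_cgf :
      HasDerivAt (fun y => ∑ i ∈ S, logCoshRem y (h i) + y * ∑ i ∈ S, Real.tanh (h i))
        (∑ i ∈ S, (Real.tanh (0 + h i) - Real.tanh (h i)) + 1 * ∑ i ∈ S, Real.tanh (h i)) 0 :=
    (HasDerivAt.fun_sum fun i _ => hasDerivAt_logCoshRem 0 (h i)).add
      ((hasDerivAt_id (0 : ℝ)).mul_const _)
  simp_rw [gibbsMean_nullEnergy_exp_mag] at deriv_mgf
  simpa [logCoshRem_zero_left] using deriv_mgf.unique deriv_cgf.exp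

variable {S}

lemma gibbsMean_nullEnergy_exp_mag_sq_le (hS : S.Nonempty) {β a : ℝ} (hβ : 0 ≤ β)
    (hβa : β * a < 1) (hrem : ∀ y, ∑ i ∈ S, logCoshRem y (h i) ≤ S.card * (a * y ^ 2 / 2)) :
    gibbsMean (nullEnergy h) (fun σ => Real.exp (β / (2 * (S.card : ℝ)) * mag S σ ^ 2)) ≤
      √(2 / (1 - β * a)) *
        Real.exp (β / (1 - β * a) * ((∑ i ∈ S, Real.tanh (h i)) ^ 2 / S.card)) := by
  set k : ℝ := (S.card : ℝ) with hk_def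
  have hk : 0 < k := by
    rw [hk_def]
    exact_mod_cast hS.card_pos
  set τ := ∑ i ∈ S, Real.tanh (h i)
  set d := 1 - β * a
  have hd : 0 < d := sub_pos.2 hβa
  obtain ⟨b, hb⟩ : ∃ b : ℝ, b ^ 2 = β := ⟨√β, Real.sq_sqrt hβ⟩
  have complete_square : ∀ x : ℝ,
      -(k * x ^ 2 / 2) + (∑ i ∈ S, logCoshRem (b * x) (h i) + b * x * τ) ≤
        β / d * (τ ^ 2 / k) + -(k * d / 4) * x ^ 2 := fun x => by
    have hremx := hrem (b * x)
    rw [mul_pow, hb] at hremx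
    have square : β / d * (τ ^ 2 / k) + k * d / 4 * x ^ 2 - b * x * τ =
        (b * τ - k * d * x / 2) ^ 2 / (k * d) := by
      rw [← hb]
      field_simp
      ring
    have square_nonneg : 0 ≤ (b * τ - k * d * x / 2) ^ 2 / (k * d) := by positivity
    linarith
  have gaussian_const : √(Real.pi / (k * d / 4)) = √(2 * Real.pi / k) * √(2 / d) := by
    rw [← Real.sqrt_mul (by positivity)]
    congr 1
    field_simp
    norm_num
  have hsqrt : 0 < √(2 * Real.pi / k) := Real.sqrt_pos.2 (by positivity)
  refine le_of_mul_le_mul_left ?_ hsqrt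
  rw [← hb, ← integral_exp_neg_sq_mul_gibbsMean _ _ hk, hb]
  calc _ ≤ ∫ x : ℝ, Real.exp (β / d * (τ ^ 2 / k)) * Real.exp (-(k * d / 4) * x ^ 2) := by
        refine integral_mono_of_nonneg (ae_of_all _ fun x => mul_nonneg (Real.exp_pos _).le
          (gibbsMean_nonneg fun σ => (Real.exp_pos _).le))
          ((integrable_exp_neg_mul_sq (by positivity)).const_mul _) (ae_of_all _ fun x => ?_)
        simp only [gibbsMean_nullEnergy_exp_mag, ← Real.exp_add]
        exact Real.exp_le_exp.2 (complete_square x)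
    _ = _ := by
        rw [integral_const_mul, integral_gaussian, gaussian_const]
        ring

lemma sum_nullProb_exp_mag_sq_le {μ : Measure ℝ} [IsProbabilityMeasure μ] [μ.IsNegInvariant]
    (hS : S.Nonempty) {β : ℝ} (hβ : 0 ≤ β) (hβ1 : β < 1) :
    ∑ σ : Config n, nullProb μ σ * Real.exp (β / (2 * (S.card : ℝ)) * mag S σ ^ 2) ≤
      √(2 / (1 - β)) := by
  have zero_field := gibbsMean_nullEnergy_exp_mag_sq_le (fun _ => 0) hS (a := 1) hβ
    (by rwa [mul_one]) fun y => by
      simpa using mul_le_mul_of_nonneg_left (logCoshRem_zero_right_le y)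
        (Nat.cast_nonneg (α := ℝ) S.card)
  simpa [gibbsMean, gibbs_nullEnergy_zero, nullProb_eq] using zero_field

lemma gibbsMean_plantedEnergy_exp_le (hS : S.Nonempty) {θ δ : ℝ} (hθ : 0 < θ) (hδ : 0 < δ)
    (hrem : ∀ y, ∑ i ∈ S, logCoshRem y (h i) ≤ S.card * ((1 - δ) * y ^ 2 / (2 * θ))) :
    gibbsMean (plantedEnergy θ S h) (fun σ => Real.exp (θ * δ / 2 * (mag S σ ^ 2 / S.card))) ≤
      √(2 / δ ^ 2) *
        Real.exp (θ * (1 + δ) / δ ^ 2 * ((∑ i ∈ S, Real.tanh (h i)) ^ 2 / S.card)) := by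
  have gap : 1 - θ * (1 + δ) * ((1 - δ) / θ) = δ ^ 2 := by
    field_simp
    ring
  have null_bound := gibbsMean_nullEnergy_exp_mag_sq_le h hS (β := θ * (1 + δ))
    (a := (1 - δ) / θ) (by positivity) (by have := pow_pos hδ 2; linarith)
    (fun y => (hrem y).trans (le_of_eq (by field_simp)))
  rw [gap] at null_bound
  refine le_trans (Finset.sum_le_sum fun σ _ => ?_) null_bound
  refine (mul_le_mul_of_nonneg_right (gibbs_plantedEnergy_le S h σ hθ.le)
    (Real.exp_pos _).le).trans (le_of_eq ?_)
  rw [mul_assoc, ← Real.exp_add]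
  congr 2
  field_simp

end NullField

/-- Lowering the exponent by a factor `s` leaves `exp (τ² / (4k))` with `τ` the sum of the local
means `tanh (h i)`; Jensen then trades `τ` for the magnetization of a free spin system in the
same field, whose law averages over the field to the uniform one. -/
lemma exists_gibbsMean_plantedEnergy_le_nullEnergy {θ δ : ℝ} (hθ : 0 < θ) (hδ0 : 0 < δ)
    (hδ1 : δ < 1) :
    ∃ c > 0, ∃ A > 0, ∀ {n : ℕ} {S : Finset (Fin n)}, S.Nonempty → ∀ h : Fin n → ℝ,
      (∀ y, ∑ i ∈ S, logCoshRem y (h i) ≤ S.card * ((1 - δ) * y ^ 2 / (2 * θ))) →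
      gibbsMean (plantedEnergy θ S h) (fun σ => Real.exp (c * (mag S σ ^ 2 / S.card))) ≤
        A * gibbsMean (nullEnergy h)
          fun σ => Real.exp (1 / 2 / (2 * (S.card : ℝ)) * mag S σ ^ 2) := by
  set D := θ * (1 + δ) / δ ^ 2
  set A := √(2 / δ ^ 2)
  have hA : 1 ≤ A := by
    rw [Real.one_le_sqrt, le_div_iff₀ (by positivity)]
    nlinarith
  set s := min 1 (1 / (4 * D))
  have hs0 : 0 < s := lt_min one_pos (by positivity)
  have hs1 : s ≤ 1 := min_le_left _ _
  have hsD : s * D ≤ 1 / 4 := by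
    have : s ≤ 1 / (4 * D) := min_le_right _ _
    rw [le_div_iff₀ (by positivity)] at this
    linarith
  refine ⟨s * (θ * δ / 2), by positivity, A, by positivity, fun {n S} hS h hrem => ?_⟩
  set τ := ∑ i ∈ S, Real.tanh (h i)
  calc gibbsMean (plantedEnergy θ S h)
        (fun σ => Real.exp (s * (θ * δ / 2) * (mag S σ ^ 2 / S.card)))
      ≤ gibbsMean (plantedEnergy θ S h)
          (fun σ => Real.exp (θ * δ / 2 * (mag S σ ^ 2 / S.card))) ^ s := by
        simp_rw [mul_assoc s]
        exact gibbsMean_exp_mul_le_rpow _ _ hs0 hs1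
    _ ≤ (A * Real.exp (D * (τ ^ 2 / S.card))) ^ s :=
        Real.rpow_le_rpow (gibbsMean_nonneg fun σ => (Real.exp_pos _).le)
          (gibbsMean_plantedEnergy_exp_le h hS hθ hδ0 hrem) hs0.le
    _ = A ^ s * Real.exp (s * D * (τ ^ 2 / S.card)) := by
        rw [Real.mul_rpow (by positivity) (Real.exp_pos _).le, ← Real.exp_mul]
        ring_nf
    _ ≤ A * Real.exp (1 / 4 * (τ ^ 2 / S.card)) := by
        gcongr
        exact Real.rpow_le_self_of_one_le hA hs1
    _ = A * Real.exp (1 / 2 / (2 * (S.card : ℝ)) * gibbsMean (nullEnergy h) (mag S) ^ 2) := by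
        rw [gibbsMean_nullEnergy_mag]
        congr 2
        field_simp
        ring
    _ ≤ _ := by
        gcongr
        exact exp_mul_sq_gibbsMean_le _ _ (by positivity)

lemma integral_le_measureReal_mul_add_integral {Ω : Type*} [MeasurableSpace Ω] {P : Measure Ω}
    [IsFiniteMeasure P] {f g : Ω → ℝ} {B : Set Ω} {M : ℝ} (hB : MeasurableSet B)
    (hf : ∀ ω, 0 ≤ f ω) (hg : ∀ ω, 0 ≤ g ω) (hgi : Integrable g P)
    (hfB : ∀ ω ∈ B, f ω ≤ M) (hfg : ∀ ω ∉ B, f ω ≤ g ω) :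
    ∫ ω, f ω ∂P ≤ P.real B * M + ∫ ω, g ω ∂P := by
  have hMi : Integrable (B.indicator fun _ => M) P := (integrable_const _).indicator hB
  calc ∫ ω, f ω ∂P ≤ ∫ ω, (B.indicator (fun _ => M) + g) ω ∂P := by
        refine integral_mono_of_nonneg (ae_of_all _ hf) (hMi.add hgi) (ae_of_all _ fun ω => ?_)
        by_cases hω : ω ∈ B
        · simpa [hω] using (hfB ω hω).trans (le_add_of_nonneg_right (hg ω))
        · simpa [hω] using hfg ω hω
    _ = P.real B * M + ∫ ω, g ω ∂P := by
        rw [integral_add' hMi hgi, integral_indicator_const _ hB, smul_eq_mul]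

theorem HighTemperature.exists_sum_plantedProb_exp_le {μ : Measure ℝ} [IsProbabilityMeasure μ]
    [μ.IsNegInvariant] {θ : ℝ} (hθ : HighTemperature μ θ) :
    ∃ c > 0, ∃ C, ∀ (n : ℕ) (S : Finset (Fin n)), S.Nonempty →
      ∑ σ, plantedProb μ θ S σ * Real.exp (c * (mag S σ ^ 2 / S.card)) ≤ C := by
  obtain ⟨δ, hδ0, hδ1, c₀, hc₀, C₀, -, H⟩ := hθ.remControlled_univ
  obtain ⟨c₁, hc₁, A, hA, planted_le_null⟩ :=
    exists_gibbsMean_plantedEnergy_le_nullEnergy hθ.1 hδ0 hδ1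
  have hc : 0 < min c₀ c₁ := lt_min hc₀ hc₁
  refine ⟨min c₀ c₁, hc, C₀ + A * √(2 / (1 - 1 / 2)), fun n S hS => ?_⟩
  obtain ⟨B, hB, hBp, hrem⟩ := H n S
  have hint := integrable_gibbsMean_plantedEnergy μ 0 S
    fun σ : Config n => Real.exp (1 / 2 / (2 * (S.card : ℝ)) * mag S σ ^ 2)
  simp_rw [plantedEnergy_zero] at hint
  have null_moment := sum_nullProb_exp_mag_sq_le (μ := μ) hS (β := 1 / 2) (by norm_num)
    (by norm_num)
  simp_rw [← plantedProb_zero μ S, sum_plantedProb_mul, plantedEnergy_zero] at null_moment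
  rw [sum_plantedProb_mul]
  refine (integral_le_measureReal_mul_add_integral hB (M := Real.exp (c₀ * S.card))
    (fun h => gibbsMean_nonneg fun σ => (Real.exp_pos _).le)
    (fun h => mul_nonneg hA.le (gibbsMean_nonneg fun σ => (Real.exp_pos _).le))
    (hint.const_mul A) (fun h _ => ?_) fun h hh => ?_).trans (add_le_add ?_ ?_)
  · refine (gibbsMean_exp_mag_sq_div_card_le _ S hc.le).trans ?_
    gcongr
    exact min_le_left _ _
  · refine (gibbsMean_mono fun σ => ?_).trans
      (planted_le_null hS h fun y => hrem h hh y (Set.mem_univ y))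
    gcongr
    exact min_le_right _ _
  · calc _ ≤ C₀ * Real.exp (-(c₀ * S.card)) * Real.exp (c₀ * S.card) := by gcongr
      _ = C₀ := by rw [mul_assoc, ← Real.exp_add, neg_add_cancel, Real.exp_zero, mul_one]
  · rw [integral_const_mul]
    exact mul_le_mul_of_nonneg_left null_moment hA.le

/-! ### Noise operator and hypercontractivity on the cube -/

section Noise

open scoped BigOperators

lemma expect_mul_le_Lp_mul_Lq {ι : Type*} [Fintype ι] (f g : ι → ℝ) {p q : ℝ}
    (hpq : p.HolderConjugate q) :
    𝔼 i, f i * g i ≤ (𝔼 i, |f i| ^ p) ^ (1 / p) * (𝔼 i, |g i| ^ q) ^ (1 / q) := by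
  have nonneg : ∀ (f : ι → ℝ) (r : ℝ), 0 ≤ ∑ i, |f i| ^ r := fun f r =>
    Finset.sum_nonneg fun i _ => Real.rpow_nonneg (abs_nonneg _) _
  have exponents : 1 / p + 1 / q = 1 := by
    simpa only [one_div] using hpq.inv_add_inv_eq_one
  simp_rw [Fintype.expect_eq_sum_div_card]
  rw [Real.div_rpow (nonneg f p) (Nat.cast_nonneg _), Real.div_rpow (nonneg g q)
    (Nat.cast_nonneg _), div_mul_div_comm, ← Real.rpow_add' (Nat.cast_nonneg _)
    (by rw [exponents]; exact one_ne_zero), exponents, Real.rpow_one]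
  gcongr
  exact Real.inner_le_Lp_mul_Lq Finset.univ f g hpq

lemma expect_Lp_add_le {ι : Type*} [Fintype ι] {f g : ι → ℝ} (hf : ∀ i, 0 ≤ f i)
    (hg : ∀ i, 0 ≤ g i) {p : ℝ} (hp : 1 ≤ p) :
    (𝔼 i, (f i + g i) ^ p) ^ (1 / p) ≤ (𝔼 i, f i ^ p) ^ (1 / p) + (𝔼 i, g i ^ p) ^ (1 / p) := by
  have nonneg : ∀ {f : ι → ℝ}, (∀ i, 0 ≤ f i) → 0 ≤ ∑ i, f i ^ p := fun hf =>
    Finset.sum_nonneg fun i _ => Real.rpow_nonneg (hf i) _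
  simp_rw [Fintype.expect_eq_sum_div_card]
  rw [Real.div_rpow (nonneg hf) (Nat.cast_nonneg _), Real.div_rpow (nonneg hg) (Nat.cast_nonneg _),
    Real.div_rpow (nonneg fun i => add_nonneg (hf i) (hg i)) (Nat.cast_nonneg _), ← add_div]
  gcongr
  exact Real.Lp_add_le_of_nonneg Finset.univ hp (fun i _ => hf i) fun i _ => hg i

lemma expect_add_pow_le {ι : Type*} [Fintype ι] {f g : ι → ℝ} (hf : ∀ i, 0 ≤ f i)
    (hg : ∀ i, 0 ≤ g i) {j : ℕ} (hj : 0 < j) {a b : ℝ} (ha : 0 ≤ a) (hb : 0 ≤ b)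
    (hfa : 𝔼 i, f i ^ j ≤ a ^ j) (hgb : 𝔼 i, g i ^ j ≤ b ^ j) :
    𝔼 i, (f i + g i) ^ j ≤ (a + b) ^ j := by
  have hj0 : (0 : ℝ) < j := by exact_mod_cast hj
  have norm_le_iff : ∀ {f : ι → ℝ} {a : ℝ}, (∀ i, 0 ≤ f i) → 0 ≤ a →
      ((𝔼 i, f i ^ (j : ℝ)) ^ (1 / (j : ℝ)) ≤ a ↔ 𝔼 i, f i ^ j ≤ a ^ j) := fun hf ha => by
    rw [one_div, Real.rpow_inv_le_iff_of_pos
      (Finset.expect_nonneg fun i _ => Real.rpow_nonneg (hf i) _) ha hj0]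
    simp_rw [Real.rpow_natCast]
  exact (norm_le_iff (fun i => add_nonneg (hf i) (hg i)) (add_nonneg ha hb)).1
    ((expect_Lp_add_le hf hg (by exact_mod_cast hj)).trans
      (add_le_add ((norm_le_iff hf ha).2 hfa) ((norm_le_iff hg hb).2 hgb)))

variable {n : ℕ}

/-- The density at `τ`, relative to the uniform law, of a spin configuration that is
`ρ`-correlated with `σ`, site by site. -/
noncomputable def noiseKernel (ρ : ℝ) (σ τ : Config n) : ℝ :=
  ∏ i, (1 + ρ * (spin (σ i) * spin (τ i)))

/-- The noise operator of correlation `ρ`. -/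
noncomputable def noise (ρ : ℝ) (f : Config n → ℝ) (σ : Config n) : ℝ :=
  𝔼 τ, noiseKernel ρ σ τ * f τ

/-- The Walsh character of the set `A`. -/
noncomputable def walsh (A : Finset (Fin n)) (σ : Config n) : ℝ := ∏ i ∈ A, spin (σ i)

/-- The Walsh coefficient at `A` of the weight `P` on the cube, with respect to the counting
measure: for a probability `P` it is the expectation of `walsh A`. -/
noncomputable def coef (P : Config n → ℝ) (A : Finset (Fin n)) : ℝ := ∑ σ, P σ * walsh A σ

lemma expect_config (f : Config n → ℝ) : 𝔼 σ, f σ = ((2 : ℝ) ^ n)⁻¹ * ∑ σ, f σ := by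
  rw [Fintype.expect_eq_sum_div_card, card_config, div_eq_inv_mul, Nat.cast_pow, Nat.cast_ofNat]

lemma expect_config_prod (f : Fin n → ℤˣ → ℝ) :
    𝔼 σ : Config n, ∏ i, f i (σ i) = ∏ i, ((f i 1 + f i (-1)) / 2) := by
  rw [expect_config, sum_config_prod, Finset.prod_div_distrib]
  simp [div_eq_inv_mul]

lemma expect_config_succ (f : Config (n + 1) → ℝ) :
    𝔼 σ, f σ = 𝔼 σ : Config n, (f (Fin.cons 1 σ) + f (Fin.cons (-1) σ)) / 2 := by
  rw [expect_config, expect_config, ← (Fin.consEquiv fun _ : Fin (n + 1) => ℤˣ).sum_comp,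
    Fintype.sum_prod_type, sum_units_int, ← Finset.sum_add_distrib, Finset.mul_sum, Finset.mul_sum]
  refine Finset.sum_congr rfl fun σ _ => ?_
  simp only [Fin.consEquiv, Equiv.coe_fn_mk]
  rw [pow_succ]
  field_simp

lemma noiseKernel_comm (ρ : ℝ) (σ τ : Config n) : noiseKernel ρ σ τ = noiseKernel ρ τ σ := by
  unfold noiseKernel
  simp_rw [mul_comm (spin (σ _))]

lemma expect_noiseKernel_mul (ρ ρ' : ℝ) (τ η : Config n) :
    𝔼 σ, noiseKernel ρ σ τ * noiseKernel ρ' σ η = noiseKernel (ρ * ρ') τ η := by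
  unfold noiseKernel
  simp_rw [← Finset.prod_mul_distrib]
  rw [expect_config_prod
    fun i s => (1 + ρ * (spin s * spin (τ i))) * (1 + ρ' * (spin s * spin (η i)))]
  refine Finset.prod_congr rfl fun i _ => ?_
  rw [spin_neg, spin_one]
  ring

lemma noiseKernel_eq_sum_walsh (ρ : ℝ) (σ τ : Config n) :
    noiseKernel ρ σ τ = ∑ A : Finset (Fin n), ρ ^ A.card * (walsh A σ * walsh A τ) := by
  unfold noiseKernel walsh
  rw [Finset.prod_one_add, Finset.powerset_univ]
  refine Finset.sum_congr rfl fun A _ => ?_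
  rw [Finset.prod_mul_distrib, Finset.prod_mul_distrib, Finset.prod_const]

lemma noiseKernel_one (σ τ : Config n) :
    noiseKernel 1 σ τ = if σ = τ then (2 : ℝ) ^ n else 0 := by
  unfold noiseKernel
  split_ifs with h
  · subst h
    simp_rw [spin_mul_self]
    norm_num
  · obtain ⟨i, hi⟩ := Function.ne_iff.1 h
    refine Finset.prod_eq_zero (Finset.mem_univ i) ?_
    rw [Int.units_ne_iff_eq_neg.1 hi, spin_neg, neg_mul, spin_mul_self]
    norm_num

lemma expect_noise_mul (ρ : ℝ) (f g : Config n → ℝ) :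
    𝔼 σ, noise ρ f σ * g σ = 𝔼 σ, f σ * noise ρ g σ := by
  simp_rw [noise, Finset.expect_mul, Finset.mul_expect]
  rw [Finset.expect_comm]
  refine Finset.expect_congr rfl fun τ _ => Finset.expect_congr rfl fun σ _ => ?_
  rw [noiseKernel_comm]
  ring

lemma noise_cons (ρ : ℝ) (f : Config (n + 1) → ℝ) (s : ℤˣ) (σ : Config n) :
    noise ρ f (Fin.cons s σ) =
      noise ρ (fun τ => (f (Fin.cons 1 τ) + f (Fin.cons (-1) τ)) / 2) σ +
        ρ * spin s * noise ρ (fun τ => (f (Fin.cons 1 τ) - f (Fin.cons (-1) τ)) / 2) σ := by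
  unfold noise
  rw [expect_config_succ, Finset.mul_expect, ← Finset.expect_add_distrib]
  refine Finset.expect_congr rfl fun τ _ => ?_
  simp only [noiseKernel, Fin.prod_univ_succ, Fin.cons_zero, Fin.cons_succ, spin_neg, spin_one]
  ring

lemma sum_range_even (t : ℕ → ℝ) (j : ℕ) :
    ∑ m ∈ Finset.range (2 * j + 1), t m * ((1 + (-1) ^ m) / 2) =
      ∑ i ∈ Finset.range (j + 1), t (2 * i) := by
  induction j with
  | zero => simp
  | succ j ih =>
    have odd_term : (-1 : ℝ) ^ (2 * j + 1) = -1 := Odd.neg_one_pow ⟨j, rfl⟩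
    have even_term : (-1 : ℝ) ^ (2 * j + 1 + 1) = 1 := Even.neg_one_pow ⟨j + 1, by ring⟩
    rw [show 2 * (j + 1) + 1 = 2 * j + 1 + 1 + 1 by ring, Finset.sum_range_succ,
      Finset.sum_range_succ, ih, Finset.sum_range_succ _ (j + 1), odd_term, even_term,
      show 2 * (j + 1) = 2 * j + 1 + 1 by ring]
    ring

lemma add_pow_add_sub_pow_div_two (x y : ℝ) (j : ℕ) :
    ((x + y) ^ (2 * j) + (x - y) ^ (2 * j)) / 2 =
      ∑ i ∈ Finset.range (j + 1), (y ^ 2) ^ i * (x ^ 2) ^ (j - i) * (2 * j).choose (2 * i) := by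
  have even_terms := sum_range_even (fun m => y ^ m * x ^ (2 * j - m) * (2 * j).choose m) j
  simp_rw [← Nat.mul_sub, pow_mul] at even_terms
  rw [← even_terms, add_comm x, add_pow, sub_eq_neg_add, add_pow, ← Finset.sum_add_distrib,
    Finset.sum_div]
  refine Finset.sum_congr rfl fun m _ => ?_
  rw [neg_pow y m]
  ring

lemma two_point_inequality {j : ℕ} (hj : 0 < j) (x y : ℝ) :
    ((x + 1 / (2 * j) * y) ^ (2 * j) + (x - 1 / (2 * j) * y) ^ (2 * j)) / 2 ≤
      (x ^ 2 + y ^ 2) ^ j := by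
  rw [add_pow_add_sub_pow_div_two, add_comm (x ^ 2), add_pow]
  refine Finset.sum_le_sum fun i hi => ?_
  have choose_pos : (1 : ℝ) ≤ j.choose i := by
    exact_mod_cast Nat.choose_pos (Nat.lt_succ_iff.1 (Finset.mem_range.1 hi))
  have choose_le : ((2 * j).choose (2 * i) : ℝ) ≤ (2 * j : ℝ) ^ (2 * i) := by
    exact_mod_cast Nat.choose_le_pow (2 * j) (2 * i)
  have noise_beats_choose :
      (1 / (2 * j : ℝ)) ^ (2 * i) * (2 * j).choose (2 * i) ≤ j.choose i := by
    refine le_trans ?_ choose_pos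
    rw [one_div_pow, one_div_mul_eq_div]
    exact div_le_one_of_le₀ choose_le (by positivity)
  calc ((1 / (2 * j) * y) ^ 2) ^ i * (x ^ 2) ^ (j - i) * ((2 * j).choose (2 * i) : ℝ)
      = (1 / (2 * j : ℝ)) ^ (2 * i) * (2 * j).choose (2 * i) *
          ((y ^ 2) ^ i * (x ^ 2) ^ (j - i)) := by
        rw [pow_mul (1 / (2 * j : ℝ))]
        ring
    _ ≤ j.choose i * ((y ^ 2) ^ i * (x ^ 2) ^ (j - i)) := by gcongr
    _ = (y ^ 2) ^ i * (x ^ 2) ^ (j - i) * j.choose i := by ring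

/-- The correlation `1 / (2j)` is far from the optimal `1 / √(2j - 1)`, but any positive one
would do, and it makes the two-point inequality hold term by term. -/
theorem expect_noise_pow_le {j : ℕ} (hj : 0 < j) (g : Config n → ℝ) :
    𝔼 σ, noise (1 / (2 * j)) g σ ^ (2 * j) ≤ (𝔼 σ, g σ ^ 2) ^ j := by
  induction n with
  | zero => simp [noise, noiseKernel, pow_mul]
  | succ n ih =>
    set a : Config n → ℝ := fun τ => (g (Fin.cons 1 τ) + g (Fin.cons (-1) τ)) / 2
    set b : Config n → ℝ := fun τ => (g (Fin.cons 1 τ) - g (Fin.cons (-1) τ)) / 2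
    have pythagoras : 𝔼 σ, g σ ^ 2 = 𝔼 σ, a σ ^ 2 + 𝔼 σ, b σ ^ 2 := by
      rw [expect_config_succ, ← Finset.expect_add_distrib]
      refine Finset.expect_congr rfl fun σ _ => ?_
      simp only [a, b]
      ring
    rw [pythagoras, expect_config_succ]
    refine le_trans (Finset.expect_le_expect fun σ _ => ?_) (expect_add_pow_le
      (f := fun σ => noise (1 / (2 * j)) a σ ^ 2) (g := fun σ => noise (1 / (2 * j)) b σ ^ 2)
      (fun σ => sq_nonneg _) (fun σ => sq_nonneg _) hj (Finset.expect_nonneg fun σ _ => sq_nonneg _)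
      (Finset.expect_nonneg fun σ _ => sq_nonneg _) ?_ ?_)
    · rw [noise_cons, noise_cons, spin_neg, spin_one, mul_one, mul_neg_one, neg_mul,
        ← sub_eq_add_neg]
      exact two_point_inequality hj _ _
    · simpa only [← pow_mul] using ih a
    · simpa only [← pow_mul] using ih b

theorem expect_noise_sq_le {j : ℕ} (hj : 0 < j) (f : Config n → ℝ) {p : ℝ}
    (hp : p.HolderConjugate (2 * j : ℕ)) :
    𝔼 σ, noise (1 / (2 * j)) f σ ^ 2 ≤ (𝔼 σ, |f σ| ^ p) ^ (2 / p) := by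
  set ρ : ℝ := 1 / (2 * j)
  set g := noise ρ f
  set G := 𝔼 σ, g σ ^ 2
  set F := 𝔼 σ, |f σ| ^ p
  have hG : 0 ≤ G := Finset.expect_nonneg fun σ _ => sq_nonneg _
  have hF : 0 ≤ F := Finset.expect_nonneg fun σ _ => Real.rpow_nonneg (abs_nonneg _) _
  have hypercontractive :
      (𝔼 σ, |noise ρ g σ| ^ ((2 * j : ℕ) : ℝ)) ^ (1 / ((2 * j : ℕ) : ℝ)) ≤ √G := by
    have even_power : ∀ x : ℝ, |x| ^ (2 * j) = x ^ (2 * j) := fun x => by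
      rw [pow_mul, sq_abs, pow_mul]
    simp_rw [Real.rpow_natCast, even_power]
    rw [one_div, Real.rpow_inv_le_iff_of_pos (Finset.expect_nonneg fun σ _ => by
      rw [pow_mul]; positivity) (Real.sqrt_nonneg _) (by positivity), Real.rpow_natCast, pow_mul,
      Real.sq_sqrt hG]
    exact expect_noise_pow_le hj g
  have duality : √G * √G ≤ F ^ (1 / p) * √G := calc
    √G * √G = 𝔼 σ, f σ * noise ρ g σ := by
        rw [Real.mul_self_sqrt hG, ← expect_noise_mul]
        exact Finset.expect_congr rfl fun σ _ => sq _
    _ ≤ F ^ (1 / p) * (𝔼 σ, |noise ρ g σ| ^ ((2 * j : ℕ) : ℝ)) ^ (1 / ((2 * j : ℕ) : ℝ)) :=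
        expect_mul_le_Lp_mul_Lq f (noise ρ g) hp
    _ ≤ F ^ (1 / p) * √G := by gcongr
  have sqrt_le : √G ≤ F ^ (1 / p) := by
    rcases (Real.sqrt_nonneg G).eq_or_lt with h0 | hpos
    · rw [← h0]
      positivity
    · exact le_of_mul_le_mul_right duality hpos
  calc G = √G ^ 2 := (Real.sq_sqrt hG).symm
    _ ≤ (F ^ (1 / p)) ^ 2 := by gcongr
    _ = F ^ (2 / p) := by
        rw [← Real.rpow_mul_natCast hF]
        ring_nf

/-! ### Walsh coefficients -/

lemma sum_noiseKernel_mul_mul (ρ : ℝ) (P P' : Config n → ℝ) :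
    ∑ σ, ∑ τ, noiseKernel ρ σ τ * (P σ * P' τ) =
      ∑ A, ρ ^ A.card * (coef P A * coef P' A) := by
  have expand : ∀ σ, ∑ τ, noiseKernel ρ σ τ * (P σ * P' τ) =
      ∑ A, ∑ τ, ρ ^ A.card * (P σ * walsh A σ * (P' τ * walsh A τ)) := fun σ => by
    rw [Finset.sum_comm]
    refine Finset.sum_congr rfl fun τ _ => ?_
    rw [noiseKernel_eq_sum_walsh, Finset.sum_mul]
    exact Finset.sum_congr rfl fun A _ => by ring
  simp_rw [expand]
  rw [Finset.sum_comm]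
  refine Finset.sum_congr rfl fun A _ => ?_
  rw [coef, coef, Finset.sum_mul_sum, Finset.mul_sum]
  simp_rw [Finset.mul_sum]

lemma parseval (P P' : Config n → ℝ) :
    (2 : ℝ) ^ n * ∑ σ, P σ * P' σ = ∑ A, coef P A * coef P' A := by
  have diagonal := sum_noiseKernel_mul_mul 1 P P'
  simp_rw [noiseKernel_one, one_pow, one_mul] at diagonal
  rw [← diagonal, Finset.mul_sum]
  simp [ite_mul]

lemma sum_pow_mul_coef_sq (ρ : ℝ) (P : Config n → ℝ) :
    ∑ A, (ρ * ρ) ^ A.card * coef P A ^ 2 =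
      𝔼 σ, noise ρ (fun τ => (2 : ℝ) ^ n * P τ) σ ^ 2 := by
  have noise_density : ∀ σ, noise ρ (fun τ => (2 : ℝ) ^ n * P τ) σ =
      ∑ τ, noiseKernel ρ σ τ * P τ := fun σ => by
    rw [noise, expect_config, Finset.mul_sum]
    refine Finset.sum_congr rfl fun τ _ => ?_
    field_simp
  simp_rw [noise_density, sq, Finset.sum_mul_sum, Finset.expect_sum_comm]
  rw [← sum_noiseKernel_mul_mul]
  refine Finset.sum_congr rfl fun τ _ => Finset.sum_congr rfl fun η _ => ?_
  rw [← expect_noiseKernel_mul, Finset.expect_mul]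
  exact Finset.expect_congr rfl fun σ _ => by ring

end Noise

section Walsh

variable {n : ℕ}

lemma walsh_mul (A : Finset (Fin n)) (σ τ : Config n) :
    walsh A (σ * τ) = walsh A σ * walsh A τ := by
  unfold walsh
  rw [← Finset.prod_mul_distrib]
  exact Finset.prod_congr rfl fun i _ => spin_mul _ _

lemma coef_eq_zero {P : Config n → ℝ} {A : Finset (Fin n)} (ε : Config n)
    (hP : ∀ σ, P (ε * σ) = P σ) (hε : walsh A ε = -1) : coef P A = 0 := by
  have antisymmetric : coef P A = -coef P A := by
    conv_lhs => rw [coef, ← Equiv.sum_comp (Equiv.mulLeft ε)]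
    simp only [Equiv.coe_mulLeft, hP, walsh_mul, hε, neg_one_mul, mul_neg,
      Finset.sum_neg_distrib, coef]
  linarith

lemma exists_perm_map_eq {α : Type*} [Finite α] {A B A' B' : Finset α}
    (hAB : Disjoint A B) (hAB' : Disjoint A' B') (hA : A.card = A'.card) (hB : B.card = B'.card) :
    ∃ π : Equiv.Perm α, A.map π.toEmbedding = A' ∧ B.map π.toEmbedding = B' := by
  classical
  cases nonempty_fintype α
  let e : {x // x ∈ A ∪ B} ≃ {x // x ∈ A' ∪ B'} :=
    (Equiv.Finset.union A B hAB).symm.trans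
      (((Finset.equivOfCardEq hA).sumCongr (Finset.equivOfCardEq hB)).trans
        (Equiv.Finset.union A' B' hAB'))
  refine ⟨e.extendSubtype, Finset.eq_of_subset_of_card_le ?_ (by rw [Finset.card_map, hA]),
    Finset.eq_of_subset_of_card_le ?_ (by rw [Finset.card_map, hB])⟩
  · refine Finset.map_subset_iff_subset_preimage.2 fun x hx => ?_
    rw [Finset.mem_preimage, Equiv.coe_toEmbedding,
      e.extendSubtype_apply_of_mem x (Finset.mem_union_left B hx)]
    simp [e, Equiv.Finset.union_symm_left hAB hx]
  · refine Finset.map_subset_iff_subset_preimage.2 fun x hx => ?_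
    rw [Finset.mem_preimage, Equiv.coe_toEmbedding,
      e.extendSubtype_apply_of_mem x (Finset.mem_union_right A hx)]
    simp [e, Equiv.Finset.union_symm_right hAB hx]

variable {μ : Measure ℝ} [IsProbabilityMeasure μ] {θ : ℝ} {S S' A A' : Finset (Fin n)}

lemma coef_plantedProb_empty : coef (plantedProb μ θ S) ∅ = 1 := by
  simp [coef, walsh, sum_plantedProb]

lemma coef_plantedProb_of_not_subset [μ.IsNegInvariant] (hA : ¬A ⊆ S) :
    coef (plantedProb μ θ S) A = 0 := by
  obtain ⟨i, hiA, hiS⟩ := Finset.not_subset.1 hA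
  refine coef_eq_zero (Pi.mulSingle i (-1)) (plantedProb_mul_left μ θ fun τ => ?_) ?_
  · congr 1
    refine Finset.sum_congr rfl fun j hj => ?_
    rw [Pi.mul_apply, Pi.mulSingle_eq_of_ne (ne_of_mem_of_not_mem hj hiS), one_mul]
  · rw [walsh, ← Finset.mul_prod_erase _ _ hiA, Pi.mulSingle_eq_same, spin_neg, spin_one,
      Finset.prod_eq_one, mul_one]
    intro j hj
    rw [Pi.mulSingle_eq_of_ne (Finset.ne_of_mem_erase hj), spin_one]

lemma coef_plantedProb_of_odd_card [μ.IsNegInvariant] (hA : Odd A.card) :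
    coef (plantedProb μ θ S) A = 0 := by
  refine coef_eq_zero (fun _ => -1) (plantedProb_mul_left μ θ fun τ => ?_) ?_
  · unfold mag
    simp_rw [Pi.mul_apply, neg_one_mul, spin_neg, Finset.sum_neg_distrib, neg_sq]
  · rw [walsh, Finset.prod_const, spin_neg, spin_one, hA.neg_one_pow]

lemma coef_plantedProb_map (π : Equiv.Perm (Fin n)) :
    coef (plantedProb μ θ (S.map π.toEmbedding)) (A.map π.toEmbedding) =
      coef (plantedProb μ θ S) A := by
  unfold coef walsh
  rw [← (Equiv.arrowCongr π (Equiv.refl ℤˣ)).sum_comp]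
  refine Finset.sum_congr rfl fun σ _ => ?_
  have relabel : (Equiv.arrowCongr π (Equiv.refl ℤˣ)) σ ∘ π = σ := by
    ext i
    simp
  rw [plantedProb_map, relabel, Finset.prod_map]
  simp

lemma coef_plantedProb_congr_card (hA : A ⊆ S) (hA' : A' ⊆ S') (hS : S.card = S'.card)
    (hcard : A.card = A'.card) : coef (plantedProb μ θ S) A = coef (plantedProb μ θ S') A' := by
  obtain ⟨π, rfl, hπ⟩ := exists_perm_map_eq Finset.disjoint_sdiff Finset.disjoint_sdiff hcard
    (by rw [Finset.card_sdiff_of_subset hA, Finset.card_sdiff_of_subset hA', hS, hcard] :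
      (S \ A).card = (S' \ A').card)
  rw [← Finset.union_sdiff_of_subset hA', ← hπ, ← Finset.map_union,
    Finset.union_sdiff_of_subset hA, coef_plantedProb_map]

lemma plantedProb_le [μ.IsNegInvariant] (hθ : 0 ≤ θ) (S : Finset (Fin n)) (σ : Config n) :
    plantedProb μ θ S σ ≤
      ((2 : ℝ) ^ n)⁻¹ * Real.exp (θ / (2 * (S.card : ℝ)) * mag S σ ^ 2) := by
  have integrable_null := integrable_gibbs_plantedEnergy μ 0 S σ
  simp_rw [plantedEnergy_zero] at integrable_null
  rw [← nullProb_eq μ σ, nullProb, ← integral_mul_const]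
  exact integral_mono (integrable_gibbs_plantedEnergy μ θ S σ) (integrable_null.mul_const _)
    fun h => gibbs_plantedEnergy_le S h σ hθ

/-! ### Correlation of two planted likelihood ratios -/

open scoped BigOperators in
lemma expect_density_rpow_le [μ.IsNegInvariant] (hθ : 0 ≤ θ) (S : Finset (Fin n)) {c p : ℝ}
    (hp : 1 ≤ p) (hc : θ * (p - 1) / 2 ≤ c) :
    𝔼 σ, |2 ^ n * plantedProb μ θ S σ| ^ p ≤
      ∑ σ, plantedProb μ θ S σ * Real.exp (c * (mag S σ ^ 2 / S.card)) := by
  have hN : (0 : ℝ) < 2 ^ n := by positivity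
  rw [expect_config, Finset.mul_sum]
  refine Finset.sum_le_sum fun σ _ => ?_
  have hP := plantedProb_nonneg μ θ S σ
  have density_le : 2 ^ n * plantedProb μ θ S σ ≤
      Real.exp (θ / (2 * (S.card : ℝ)) * mag S σ ^ 2) := by
    rw [← le_inv_mul_iff₀ hN]
    exact plantedProb_le hθ S σ
  have power_le : (2 ^ n * plantedProb μ θ S σ) ^ (p - 1) ≤
      Real.exp (c * (mag S σ ^ 2 / S.card)) := calc
    (2 ^ n * plantedProb μ θ S σ) ^ (p - 1)
      ≤ Real.exp (θ / (2 * (S.card : ℝ)) * mag S σ ^ 2) ^ (p - 1) :=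
        Real.rpow_le_rpow (by positivity) density_le (sub_nonneg.2 hp)
    _ = Real.exp (θ * (p - 1) / 2 * (mag S σ ^ 2 / S.card)) := by
        rw [← Real.exp_mul]
        ring_nf
    _ ≤ Real.exp (c * (mag S σ ^ 2 / S.card)) := by gcongr
  calc ((2 : ℝ) ^ n)⁻¹ * |2 ^ n * plantedProb μ θ S σ| ^ p
      = plantedProb μ θ S σ * (2 ^ n * plantedProb μ θ S σ) ^ (p - 1) := by
        rw [abs_of_nonneg (by positivity), ← add_sub_cancel 1 p,
          Real.rpow_add_of_nonneg (by positivity) zero_le_one (sub_nonneg.2 hp), Real.rpow_one,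
          add_sub_cancel, mul_assoc, inv_mul_cancel_left₀ hN.ne']
    _ ≤ plantedProb μ θ S σ * Real.exp (c * (mag S σ ^ 2 / S.card)) := by gcongr

end Walsh

theorem HighTemperature.exists_sum_pow_mul_coef_sq_le {μ : Measure ℝ} [IsProbabilityMeasure μ]
    [μ.IsNegInvariant] {θ : ℝ} (hθ : HighTemperature μ θ) :
    ∃ ρ > 0, ∃ C, ∀ (n : ℕ) (S : Finset (Fin n)), S.Nonempty →
      ∑ A, ρ ^ A.card * coef (plantedProb μ θ S) A ^ 2 ≤ C := by
  obtain ⟨c, hc, C, exp_moment⟩ := hθ.exists_sum_plantedProb_exp_le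
  obtain ⟨j, hj⟩ := exists_nat_gt (max 1 (θ / c))
  obtain ⟨hj1, hjc⟩ := max_lt_iff.1 hj
  have hj0 : 0 < j := by exact_mod_cast one_pos.trans hj1
  set q : ℝ := ((2 * j : ℕ) : ℝ) with hq
  have hqj : q = 2 * j := by rw [hq, Nat.cast_mul, Nat.cast_ofNat]
  have hpq : (q / (q - 1)).HolderConjugate q :=
    (Real.HolderConjugate.conjExponent (by linarith)).symm
  set p := q / (q - 1) with hp
  have exponent_small : θ * (p - 1) / 2 ≤ c := by
    have hp_sub : p - 1 = 1 / (q - 1) := by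
      rw [hp, div_sub_one (by linarith), sub_sub_cancel]
    rw [div_lt_iff₀ hc] at hjc
    rw [hp_sub, mul_one_div, div_div, div_le_iff₀ (by linarith)]
    nlinarith
  refine ⟨1 / (2 * j) * (1 / (2 * j)), by positivity, C ^ (2 / p), fun n S hS => ?_⟩
  rw [sum_pow_mul_coef_sq]
  refine (expect_noise_sq_le hj0 _ hpq).trans ?_
  refine Real.rpow_le_rpow
    (Finset.expect_nonneg fun σ _ => Real.rpow_nonneg (abs_nonneg _) _) ?_
    (div_nonneg zero_le_two hpq.nonneg)
  exact (expect_density_rpow_le hθ.1.le S hpq.lt.le exponent_small).trans (exp_moment n S hS)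

lemma descFactorial_mul_pow_le {r k : ℕ} (hrk : r ≤ k) (a : ℕ) :
    r.descFactorial a * k ^ a ≤ r ^ a * k.descFactorial a := by
  induction a with
  | zero => simp
  | succ a ih =>
    have ratio_le : (r - a) * k ≤ r * (k - a) := by
      have := Nat.mul_le_mul_left a hrk
      rw [Nat.sub_mul, Nat.mul_sub, mul_comm r a]
      omega
    rw [Nat.descFactorial_succ, Nat.descFactorial_succ, pow_succ, pow_succ]
    calc (r - a) * r.descFactorial a * (k ^ a * k)
        = (r - a) * k * (r.descFactorial a * k ^ a) := by ring
      _ ≤ r * (k - a) * (r ^ a * k.descFactorial a) := Nat.mul_le_mul ratio_le ih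
      _ = r ^ a * r * ((k - a) * k.descFactorial a) := by ring

lemma choose_le_pow_mul_choose {r k : ℕ} (hrk : r ≤ k) (hk : 0 < k) (a : ℕ) :
    (r.choose a : ℝ) ≤ (r / k : ℝ) ^ a * k.choose a := by
  have scaled := descFactorial_mul_pow_le hrk a
  rw [Nat.descFactorial_eq_factorial_mul_choose, Nat.descFactorial_eq_factorial_mul_choose,
    mul_assoc, mul_left_comm (r ^ a)] at scaled
  rw [div_pow, div_mul_eq_mul_div, le_div_iff₀ (by positivity)]
  exact_mod_cast Nat.le_of_mul_le_mul_left scaled a.factorial_pos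

lemma sum_powersetCard_le_pow_mul {α : Type*} {R S : Finset α} (hRS : R ⊆ S) (hS : S.Nonempty)
    {a : ℕ} {f : Finset α → ℝ} (hf : ∀ A, 0 ≤ f A)
    (hconst : ∀ A ⊆ S, ∀ B ⊆ S, A.card = a → B.card = a → f A = f B) :
    ∑ A ∈ R.powersetCard a, f A ≤ (R.card / S.card : ℝ) ^ a * ∑ A ∈ S.powersetCard a, f A := by
  rcases (R.powersetCard a).eq_empty_or_nonempty with h | ⟨B, hB⟩
  · rw [h, Finset.sum_empty]
    exact mul_nonneg (by positivity) (Finset.sum_nonneg fun A _ => hf A)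
  obtain ⟨hBR, hBa⟩ := Finset.mem_powersetCard.1 hB
  have sum_eq : ∀ {T}, T ⊆ S → ∑ A ∈ T.powersetCard a, f A = T.card.choose a * f B := fun hT => by
    rw [← Finset.card_powersetCard, ← nsmul_eq_mul]
    refine Finset.sum_eq_card_nsmul fun A hA => ?_
    obtain ⟨hAT, hAa⟩ := Finset.mem_powersetCard.1 hA
    exact hconst A (hAT.trans hT) B (hBR.trans hRS) hAa hBa
  rw [sum_eq hRS, sum_eq subset_rfl, ← mul_assoc]
  gcongr
  · exact hf B
  · exact choose_le_pow_mul_choose (Finset.card_le_card hRS) hS.card_pos a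

section Overlap

variable {μ : Measure ℝ} [IsProbabilityMeasure μ] [μ.IsNegInvariant] {θ : ℝ} {n : ℕ}
  {R S S' : Finset (Fin n)}

lemma correlation_eq_sum_powerset (h : S.card = S'.card) :
    (2 : ℝ) ^ n * ∑ σ, plantedProb μ θ S σ * plantedProb μ θ S' σ =
      ∑ A ∈ (S ∩ S').powerset, coef (plantedProb μ θ S) A ^ 2 := by
  rw [parseval, ← Finset.sum_subset (Finset.subset_univ (S ∩ S').powerset)]
  · refine Finset.sum_congr rfl fun A hA => ?_
    obtain ⟨hAS, hAS'⟩ := Finset.subset_inter_iff.1 (Finset.mem_powerset.1 hA)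
    rw [sq, coef_plantedProb_congr_card hAS' hAS h.symm rfl]
  · intro A _ hA
    rw [Finset.mem_powerset, Finset.subset_inter_iff, not_and_or] at hA
    rcases hA with hA | hA
    · rw [coef_plantedProb_of_not_subset hA, zero_mul]
    · rw [coef_plantedProb_of_not_subset hA, mul_zero]

/-- The Walsh coefficients of order zero and one are `1` and `0`, so only orders `a ≥ 2` are
affected by the comparison `(|R| / |S|) ^ a ≤ (|R| / |S|) ^ 2 * ρ ^ (a - 2)`. -/
lemma sum_powerset_coef_sq_le (hRS : R ⊆ S) (hS : S.Nonempty) {ρ : ℝ} (hρ : 0 < ρ)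
    (hR : (R.card / S.card : ℝ) ≤ ρ) :
    ∑ A ∈ R.powerset, coef (plantedProb μ θ S) A ^ 2 ≤
      1 + (R.card / S.card : ℝ) ^ 2 / ρ ^ 2 *
        ∑ A ∈ S.powerset, ρ ^ A.card * coef (plantedProb μ θ S) A ^ 2 := by
  set P := plantedProb μ θ S
  set x : ℝ := R.card / S.card
  set level : ℕ → ℝ := fun a => ∑ A ∈ S.powersetCard a, ρ ^ A.card * coef P A ^ 2 with hlevel
  have level_nonneg : ∀ a, 0 ≤ level a := fun a => Finset.sum_nonneg fun A _ => by positivity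
  have level_le : ∀ a, ∑ A ∈ R.powersetCard (a + 1), coef P A ^ 2 ≤
      x ^ 2 / ρ ^ 2 * level (a + 1) := by
    rintro (_ | a)
    · rw [Finset.sum_eq_zero fun A hA => by
        rw [coef_plantedProb_of_odd_card (by rw [(Finset.mem_powersetCard.1 hA).2]; exact odd_one),
          zero_pow two_ne_zero]]
      exact mul_nonneg (by positivity) (level_nonneg _)
    calc ∑ A ∈ R.powersetCard (a + 2), coef P A ^ 2
        ≤ x ^ (a + 2) * ∑ A ∈ S.powersetCard (a + 2), coef P A ^ 2 :=
          sum_powersetCard_le_pow_mul hRS hS (fun A => sq_nonneg _) fun A hA B hB hAa hBa => by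
            rw [coef_plantedProb_congr_card hA hB rfl (hAa.trans hBa.symm)]
      _ ≤ x ^ 2 / ρ ^ 2 * ρ ^ (a + 2) * ∑ A ∈ S.powersetCard (a + 2), coef P A ^ 2 := by
          rw [add_comm a, pow_add x, pow_add ρ, ← mul_assoc, div_mul_cancel₀ _ (by positivity)]
          gcongr
      _ = x ^ 2 / ρ ^ 2 * level (a + 2) := by
          rw [mul_assoc, Finset.mul_sum, hlevel]
          congr 1
          exact Finset.sum_congr rfl fun A hA => by rw [(Finset.mem_powersetCard.1 hA).2]
  rw [Finset.sum_powerset, Finset.sum_range_succ', Finset.powersetCard_zero, Finset.sum_singleton,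
    coef_plantedProb_empty, one_pow, add_comm]
  gcongr
  calc ∑ a ∈ Finset.range R.card, ∑ A ∈ R.powersetCard (a + 1), coef P A ^ 2
      ≤ ∑ a ∈ Finset.range S.card, x ^ 2 / ρ ^ 2 * level (a + 1) :=
        (Finset.sum_le_sum fun a _ => level_le a).trans
          (Finset.sum_le_sum_of_subset_of_nonneg
            (Finset.range_mono (Finset.card_le_card hRS)) fun a _ _ =>
              mul_nonneg (by positivity) (level_nonneg _))
    _ ≤ x ^ 2 / ρ ^ 2 * ∑ a ∈ Finset.range (S.card + 1), level a := by
        rw [← Finset.mul_sum, Finset.sum_range_succ']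
        gcongr
        exact le_add_of_nonneg_right (level_nonneg 0)
    _ = x ^ 2 / ρ ^ 2 * ∑ A ∈ S.powerset, ρ ^ A.card * coef P A ^ 2 := by
        rw [Finset.sum_powerset]

end Overlap

theorem HighTemperature.exists_correlation_le {μ : Measure ℝ} [IsProbabilityMeasure μ]
    [μ.IsNegInvariant] {θ : ℝ} (hθ : HighTemperature μ θ) :
    ∃ ρ > 0, ∃ C ≥ 0, ∀ (n k : ℕ) (S S' : Finset (Fin n)), 0 < k → S.card = k → S'.card = k →
      ((S ∩ S').card : ℝ) ≤ ρ * k →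
      (2 : ℝ) ^ n * ∑ σ, plantedProb μ θ S σ * plantedProb μ θ S' σ ≤
        1 + C * ((S ∩ S').card / k : ℝ) ^ 2 := by
  obtain ⟨ρ, hρ, C, stability⟩ := hθ.exists_sum_pow_mul_coef_sq_le
  refine ⟨ρ, hρ, max C 0 / ρ ^ 2, by positivity, fun n k S S' hk hS hS' hr => ?_⟩
  subst hS
  have hne : S.Nonempty := Finset.card_pos.1 hk
  rw [correlation_eq_sum_powerset hS'.symm]
  refine (sum_powerset_coef_sq_le Finset.inter_subset_left hne hρ
    ((div_le_iff₀ (by exact_mod_cast hk)).2 hr)).trans ?_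
  rw [div_mul_eq_mul_div, div_mul_eq_mul_div, mul_comm]
  gcongr
  refine le_trans ?_ ((stability n S hne).trans (le_max_left C 0))
  exact Finset.sum_le_sum_of_subset_of_nonneg (Finset.subset_univ _) fun A _ _ => by positivity

/-! ### Overlap with a uniform subset -/

section MeanOverlap

variable {α : Type*} [Fintype α]

/-- The mean of `|S ∩ T|` when `T` is a uniform subset of cardinality `k`. -/
noncomputable def meanOverlap (S : Finset α) (k : ℕ) : ℝ := S.card * k / Fintype.card α

lemma meanOverlap_pos {S : Finset α} (hS : S.Nonempty) {k : ℕ} (hk : 0 < k) :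
    0 < meanOverlap S k := by
  have := hS.card_pos
  have : Nonempty α := ⟨hS.choose⟩
  unfold meanOverlap
  positivity

variable [DecidableEq α]

lemma card_filter_superset_le [Nonempty α] (A : Finset α) (k : ℕ) :
    (((Finset.univ : Finset α).powersetCard k).filter (A ⊆ ·)).card ≤
      (k / Fintype.card α : ℝ) ^ A.card * (Fintype.card α).choose k := by
  rcases lt_or_ge (Fintype.card α) k with hkn | hkn
  · rw [Finset.powersetCard_eq_empty.2 (by rwa [Finset.card_univ]), Finset.filter_empty,
      Finset.card_empty, Nat.cast_zero]
    positivity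
  rcases lt_or_ge k A.card with hAk | hAk
  · rw [Finset.filter_eq_empty_iff.2 fun T hT hAT => hAk.not_ge
      ((Finset.card_le_card hAT).trans_eq (Finset.mem_powersetCard.1 hT).2), Finset.card_empty,
      Nat.cast_zero]
    positivity
  rw [Finset.card_filter_powersetCard_subset A _ k (Finset.subset_univ A) hAk, Finset.card_univ]
  have double_count : ((Fintype.card α).choose k : ℝ) * k.choose A.card =
      (Fintype.card α).choose A.card * (Fintype.card α - A.card).choose (k - A.card) := by
    exact_mod_cast Nat.choose_mul hAk
  have choose_pos : (0 : ℝ) < (Fintype.card α).choose A.card := by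
    exact_mod_cast Nat.choose_pos (hAk.trans hkn)
  refine le_of_mul_le_mul_left ?_ choose_pos
  calc ((Fintype.card α).choose A.card : ℝ) * (Fintype.card α - A.card).choose (k - A.card)
      = (Fintype.card α).choose k * k.choose A.card := double_count.symm
    _ ≤ (Fintype.card α).choose k *
          ((k / Fintype.card α : ℝ) ^ A.card * (Fintype.card α).choose A.card) := by
        gcongr
        exact choose_le_pow_mul_choose hkn Fintype.card_pos A.card
    _ = (Fintype.card α).choose A.card *
          ((k / Fintype.card α : ℝ) ^ A.card * (Fintype.card α).choose k) := by ring

/-- The right-hand side is the generating function of a Poisson variable of the same mean. -/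
lemma sum_one_add_pow_overlap_le [Nonempty α] (S : Finset α) (k : ℕ) {z : ℝ} (hz : 0 ≤ z) :
    ∑ T ∈ (Finset.univ : Finset α).powersetCard k, (1 + z) ^ (S ∩ T).card ≤
      (Fintype.card α).choose k * Real.exp (z * meanOverlap S k) := by
  have expand : ∀ T : Finset α, (1 + z) ^ (S ∩ T).card =
      ∑ A ∈ S.powerset, if A ⊆ T then z ^ A.card else 0 := fun T => by
    rw [add_comm, ← Finset.sum_pow_mul_eq_add_pow, ← Finset.sum_filter]
    simp only [one_pow, mul_one]
    refine Finset.sum_congr ?_ fun _ _ => rfl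
    ext A
    rw [Finset.mem_filter, Finset.mem_powerset, Finset.mem_powerset, Finset.subset_inter_iff]
  simp_rw [expand]
  rw [Finset.sum_comm]
  let N := Fintype.card α
  calc ∑ A ∈ S.powerset, ∑ T ∈ (Finset.univ : Finset α).powersetCard k,
        (if A ⊆ T then z ^ A.card else 0)
      ≤ ∑ A ∈ S.powerset, (z * (k / N)) ^ A.card * N.choose k := by
        refine Finset.sum_le_sum fun A _ => ?_
        rw [← Finset.sum_filter, Finset.sum_const, nsmul_eq_mul, mul_pow, mul_assoc, mul_comm]
        gcongr
        exact card_filter_superset_le A k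
    _ = (z * (k / N) + 1) ^ S.card * N.choose k := by
        rw [← Finset.sum_mul, ← Finset.sum_pow_mul_eq_add_pow]
        simp
    _ ≤ Real.exp (z * (k / N)) ^ S.card * N.choose k := by
        gcongr
        exact Real.add_one_le_exp _
    _ = N.choose k * Real.exp (z * meanOverlap S k) := by
        rw [← Real.exp_nat_mul, mul_comm, meanOverlap]
        congr 2
        ring

lemma card_le_overlap_le [Nonempty α] (S : Finset α) (k : ℕ) {z u : ℝ} (hz : 0 < z)
    (hu : 0 ≤ u) :
    (((Finset.univ : Finset α).powersetCard k).filter fun T => u ≤ ((S ∩ T).card : ℝ)).card ≤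
      (Fintype.card α).choose k * Real.exp (z * meanOverlap S k - u * Real.log z) := by
  set 𝒯 := (Finset.univ : Finset α).powersetCard k
  rw [Real.exp_sub, ← mul_div_assoc, le_div_iff₀ (Real.exp_pos _)]
  refine le_trans ?_ (sum_one_add_pow_overlap_le S k hz.le)
  calc ((𝒯.filter fun T => u ≤ ((S ∩ T).card : ℝ)).card : ℝ) * Real.exp (u * Real.log z)
      = ∑ _T ∈ 𝒯.filter fun T => u ≤ ((S ∩ T).card : ℝ), Real.exp (u * Real.log z) := by
        rw [Finset.sum_const, nsmul_eq_mul]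
    _ ≤ ∑ T ∈ 𝒯.filter fun T => u ≤ ((S ∩ T).card : ℝ), (1 + z) ^ (S ∩ T).card := by
        refine Finset.sum_le_sum fun T hT => ?_
        have log_le : Real.log z ≤ Real.log (1 + z) := Real.log_le_log hz (by linarith)
        have log_nonneg : 0 ≤ Real.log (1 + z) := Real.log_nonneg (by linarith)
        rw [← Real.exp_log (by linarith : 0 < 1 + z), ← Real.exp_nat_mul]
        exact Real.exp_le_exp.2 ((mul_le_mul_of_nonneg_left log_le hu).trans
          (mul_le_mul_of_nonneg_right (Finset.mem_filter.1 hT).2 log_nonneg))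
    _ ≤ ∑ T ∈ 𝒯, (1 + z) ^ (S ∩ T).card :=
        Finset.sum_le_sum_of_subset_of_nonneg (Finset.filter_subset _ _)
          fun _ _ _ => by positivity

lemma sum_exp_overlap_eq_le {S : Finset α} (hS : S.Nonempty) {k t : ℕ} (hk : 0 < k) (ht : 0 < t)
    {a q : ℝ} (ha : a * t ≤ 1 / 2 * Real.log (t / meanOverlap S k))
    (hq : Real.exp 1 ≤ q * √(t / meanOverlap S k)) :
    ∑ T ∈ ((Finset.univ : Finset α).powersetCard k).filter (fun T => (S ∩ T).card = t),
        Real.exp (a * ((S ∩ T).card : ℝ) ^ 2) ≤ (Fintype.card α).choose k * q ^ t := by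
  have : Nonempty α := ⟨hS.choose⟩
  have mean_pos := meanOverlap_pos hS hk
  set lam := meanOverlap S k with hlam
  set 𝒯 := (Finset.univ : Finset α).powersetCard k
  have ratio_pos : 0 < t / lam := by positivity
  have hq0 : 0 < q := pos_of_mul_pos_left ((Real.exp_pos 1).trans_le hq) (Real.sqrt_nonneg _)
  have log_q : 1 ≤ Real.log q + 1 / 2 * Real.log (t / lam) := by
    have := (Real.le_log_iff_exp_le (by positivity)).2 hq
    rwa [Real.log_mul hq0.ne' (by positivity), Real.log_sqrt ratio_pos.le, div_eq_inv_mul,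
      ← one_div] at this
  have chernoff := card_le_overlap_le S k (z := t / lam) (u := t) ratio_pos t.cast_nonneg
  rw [← hlam, div_mul_cancel₀ _ mean_pos.ne'] at chernoff
  calc ∑ T ∈ 𝒯.filter (fun T => (S ∩ T).card = t), Real.exp (a * ((S ∩ T).card : ℝ) ^ 2)
      = (𝒯.filter fun T => (S ∩ T).card = t).card * Real.exp (a * (t : ℝ) ^ 2) := by
        rw [← nsmul_eq_mul]
        exact Finset.sum_eq_card_nsmul fun T hT => by rw [(Finset.mem_filter.1 hT).2]
    _ ≤ (𝒯.filter fun T => (t : ℝ) ≤ ((S ∩ T).card : ℝ)).card * Real.exp (a * (t : ℝ) ^ 2) := by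
        gcongr with T _
        exact fun hT => by rw [hT]
    _ ≤ (Fintype.card α).choose k * Real.exp (t - t * Real.log (t / lam)) *
          Real.exp (a * (t : ℝ) ^ 2) := by gcongr
    _ = (Fintype.card α).choose k * Real.exp (t * (1 - Real.log (t / lam) + a * t)) := by
        rw [mul_assoc, ← Real.exp_add]
        ring_nf
    _ ≤ (Fintype.card α).choose k * Real.exp (t * Real.log q) := by
        gcongr
        linarith
    _ = (Fintype.card α).choose k * q ^ t := by rw [Real.exp_nat_mul, Real.exp_log hq0]

lemma sum_exp_overlap_gt_le {S : Finset α} (hS : S.Nonempty) {k : ℕ} (hk : 0 < k) {a B q : ℝ}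
    (hB : 0 ≤ B) (hq0 : 0 ≤ q) (hq : q ≤ 1 / 2) (hBq : Real.exp 1 ≤ q * √B)
    (ha : ∀ t : ℝ, B * meanOverlap S k < t → t ≤ S.card →
      a * t ≤ 1 / 2 * Real.log (t / meanOverlap S k)) :
    ∑ T ∈ ((Finset.univ : Finset α).powersetCard k).filter
        (fun T => B * meanOverlap S k < ((S ∩ T).card : ℝ)),
      Real.exp (a * ((S ∩ T).card : ℝ) ^ 2) ≤ (Fintype.card α).choose k * (2 * q) := by
  have mean_pos := meanOverlap_pos hS hk
  set lam := meanOverlap S k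
  set 𝒯 := (Finset.univ : Finset α).powersetCard k
  have overlap_mem : ∀ T ∈ 𝒯.filter (fun T => B * lam < ((S ∩ T).card : ℝ)),
      (S ∩ T).card ∈ Finset.Ico 1 (S.card + 1) := fun T hT => by
    have overlap_pos : (0 : ℝ) < (S ∩ T).card :=
      (by positivity : 0 ≤ B * lam).trans_lt (Finset.mem_filter.1 hT).2
    exact Finset.mem_Ico.2 ⟨by exact_mod_cast overlap_pos,
      Nat.lt_succ_of_le (Finset.card_le_card Finset.inter_subset_left)⟩
  have fiber_le : ∀ t ∈ Finset.Ico 1 (S.card + 1),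
      ∑ T ∈ (𝒯.filter fun T => B * lam < ((S ∩ T).card : ℝ)).filter
        (fun T => (S ∩ T).card = t), Real.exp (a * ((S ∩ T).card : ℝ) ^ 2) ≤
      (Fintype.card α).choose k * q ^ t := fun t ht => by
    obtain ⟨ht1, htS⟩ := Finset.mem_Ico.1 ht
    rcases lt_or_ge (B * lam) t with hBt | hBt
    · refine le_trans (Finset.sum_le_sum_of_subset_of_nonneg
        (Finset.filter_subset_filter _ (Finset.filter_subset _ _)) fun _ _ _ => (Real.exp_pos _).le)
        (sum_exp_overlap_eq_le hS hk ht1 (ha t hBt (by exact_mod_cast Nat.le_of_lt_succ htS))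
          (hBq.trans ?_))
      gcongr
      exact (le_div_iff₀ mean_pos).2 hBt.le
    · rw [Finset.filter_eq_empty_iff.2 fun T hT (hTt : (S ∩ T).card = t) =>
        hBt.not_gt (hTt ▸ (Finset.mem_filter.1 hT).2), Finset.sum_empty]
      positivity
  rw [← Finset.sum_fiberwise_of_maps_to overlap_mem]
  refine (Finset.sum_le_sum fiber_le).trans ?_
  rw [← Finset.mul_sum]
  gcongr
  refine (geom_sum_Ico_le_of_lt_one hq0 (by linarith)).trans ?_
  rw [pow_one, div_le_iff₀ (by linarith)]
  nlinarith

end MeanOverlap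

/-- The sample size `m` and the clique size `k` are small at level `η`: apart from `k ≪ n`, these
are the two thresholds of the theorem, with `log (n / k)` in place of `log n`. -/
structure SmallSample (η : ℝ) (n k m : ℕ) : Prop where
  card_le : (k : ℝ) ≤ η * n
  sample_le_log : (m : ℝ) ≤ η * (k * Real.log (n / k))
  sample_le_sq : (m : ℝ) ≤ η * ((n : ℝ) ^ 2 / (k : ℝ) ^ 2)

/-- The function `log u / u` decreases for `u ≥ e`, so that the bound `m ≤ η k log (n / k)`, which
treats the full overlap `t = k`, propagates to smaller overlaps. -/
lemma overlap_linear_le_half_log {n k m C η t : ℝ} (hk : 0 < k) (hn : 0 < n) (hC : 0 ≤ C)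
    (hη : C * η ≤ 1 / 2) (hη0 : 0 ≤ η) (hm : m ≤ η * (k * Real.log (n / k)))
    (ht : Real.exp 1 * (k ^ 2 / n) ≤ t) (htk : t ≤ k) :
    C * m / k ^ 2 * t ≤ 1 / 2 * Real.log (t / (k ^ 2 / n)) := by
  have mean_pos : 0 < k ^ 2 / n := by positivity
  have exp_le : Real.exp 1 ≤ t / (k ^ 2 / n) := (le_div_iff₀ mean_pos).2 ht
  have le_ratio : t / (k ^ 2 / n) ≤ n / k := by
    rw [div_le_iff₀ mean_pos]
    refine htk.trans_eq ?_
    field_simp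
  have t_eq : t = t / (k ^ 2 / n) * (k ^ 2 / n) := by field_simp
  set u := t / (k ^ 2 / n)
  have hu : 1 ≤ u := (Real.one_le_exp zero_le_one).trans exp_le
  have antitone : Real.log (n / k) / (n / k) ≤ Real.log u / u :=
    Real.log_div_self_antitoneOn exp_le (exp_le.trans le_ratio) le_ratio
  have sample_le : C * m ≤ C * η * Real.log u * (n / u) := calc
    C * m ≤ C * (η * (k * Real.log (n / k))) := by gcongr
    _ = C * η * (Real.log (n / k) / (n / k)) * n := by field_simp
    _ ≤ C * η * (Real.log u / u) * n := by gcongr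
    _ = C * η * Real.log u * (n / u) := by field_simp
  calc C * m / k ^ 2 * t = C * m * u / n := by
        rw [t_eq]
        field_simp
    _ ≤ C * η * Real.log u * (n / u) * u / n := by gcongr
    _ = C * η * Real.log u := by field_simp
    _ ≤ 1 / 2 * Real.log u := by
        have := Real.log_nonneg hu
        gcongr

lemma exp_far_overlap_le {δ D ρ η k m L : ℝ} (hδ : 0 < δ) (hD : 0 ≤ D) (hρ : 0 < ρ)
    (hk : 1 ≤ k) (hη : D * η ≤ ρ / 2) (hL : 2 / ρ * (1 + |Real.log δ|) ≤ L)
    (hm : m ≤ η * (k * L)) : Real.exp (k - ρ * k * L + D * m) ≤ δ := by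
  rw [← Real.le_log_iff_exp_le hδ]
  have hL0 : 0 ≤ L := le_trans (by positivity) hL
  have sample_le : D * m ≤ ρ / 2 * (k * L) := calc
    D * m ≤ D * (η * (k * L)) := by gcongr
    _ = D * η * (k * L) := by ring
    _ ≤ ρ / 2 * (k * L) := by gcongr
  have log_le : |Real.log δ| ≤ ρ / 2 * L - 1 := by
    rw [div_mul_eq_mul_div, div_le_iff₀ hρ] at hL
    linarith
  have := le_mul_of_one_le_left ((abs_nonneg _).trans log_le) hk
  linarith [neg_abs_le (Real.log δ)]

lemma exp_near_overlap_le {n k m C B η δ t : ℝ} (hk : 0 < k) (hn : 0 < n) (hm : 0 ≤ m)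
    (hC : 0 ≤ C) (hδ : 0 < δ) (hη : C * B ^ 2 * η ≤ Real.log (1 + δ))
    (hm_sq : m ≤ η * (n ^ 2 / k ^ 2)) (ht0 : 0 ≤ t) (ht : t ≤ B * (k ^ 2 / n)) :
    Real.exp (C * m / k ^ 2 * t ^ 2) ≤ 1 + δ := by
  rw [← Real.le_log_iff_exp_le (by linarith)]
  calc C * m / k ^ 2 * t ^ 2 ≤ C * m / k ^ 2 * (B * (k ^ 2 / n)) ^ 2 := by gcongr
    _ = C * B ^ 2 * (m * (k ^ 2 / n ^ 2)) := by field_simp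
    _ ≤ C * B ^ 2 * (η * (n ^ 2 / k ^ 2) * (k ^ 2 / n ^ 2)) := by gcongr
    _ = C * B ^ 2 * η := by field_simp
    _ ≤ Real.log (1 + δ) := hη

lemma sum_le_near_add_mid_add_far {ι : Type*} {𝒯 : Finset ι} {g r F : ι → ℝ} {a G s s' : ℝ}
    (ha : 0 ≤ a) (hF : ∀ i, 0 ≤ F i) (near : ∀ i ∈ 𝒯, r i ≤ s → F i ≤ a)
    (mid : ∀ i ∈ 𝒯, r i ≤ s' → g i ≤ F i) (far : ∀ i ∈ 𝒯, g i ≤ G) :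
    ∑ i ∈ 𝒯, g i ≤ 𝒯.card * a + ∑ i ∈ 𝒯.filter (fun i => s < r i), F i +
      (𝒯.filter fun i => s' ≤ r i).card * G := by
  have pointwise : ∀ i ∈ 𝒯, g i ≤ a + (if s < r i then F i else 0) +
      if s' ≤ r i then G else 0 := fun i hi => by
    have := hF i
    by_cases h' : s' ≤ r i
    · have := far i hi
      rw [if_pos h']
      split_ifs <;> linarith
    · have := mid i hi (not_le.1 h').le
      rw [if_neg h']
      split_ifs with h
      · linarith
      · linarith [near i hi (not_lt.1 h)]
  refine (Finset.sum_le_sum pointwise).trans_eq ?_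
  rw [Finset.sum_add_distrib, Finset.sum_add_distrib, ← Finset.sum_filter, ← Finset.sum_filter,
    Finset.sum_const, Finset.sum_const, nsmul_eq_mul, nsmul_eq_mul]

lemma exists_pos_forall_mul_le {ι : Type*} [Finite ι] (c : ι → ℝ) {b : ι → ℝ} (hb : ∀ i, 0 < b i) :
    ∃ η > 0, ∀ i, c i * η ≤ b i := by
  have small : ∀ i, ∀ᶠ η : ℝ in nhdsWithin 0 (Set.Ioi 0), c i * η ≤ b i := fun i =>
    (((continuous_const_mul (c i)).tendsto' 0 0 (mul_zero _)).eventually_le_const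
      (hb i)).filter_mono nhdsWithin_le_nhds
  obtain ⟨η, hη, hη0⟩ := ((eventually_all.2 small).and self_mem_nhdsWithin).exists
  exact ⟨η, hη0, hη⟩

/-- The number of far overlaps is superexponentially small, which beats the crude bound
`exp (D * m)` as soon as `m ≪ k log (n / k)`. -/
lemma card_far_overlap_mul_exp_le {n k m : ℕ} {S : Finset (Fin n)} {D ρ η δ : ℝ} (hk : 0 < k)
    (hS : S.card = k) (hδ : 0 < δ) (hD : 0 ≤ D) (hρ : 0 < ρ) (hη : D * η ≤ ρ / 2)
    (hηδ : η ≤ Real.exp (-(2 / ρ * (1 + |Real.log δ|)))) (hs : SmallSample η n k m) :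
    ((Finset.univ.powersetCard k).filter fun T => ρ * k ≤ ((S ∩ T).card : ℝ)).card *
      Real.exp (D * m) ≤ n.choose k * δ := by
  have hk' : (0 : ℝ) < k := by exact_mod_cast hk
  have hn : 0 < n := hk.trans_le (by simpa [hS] using Finset.card_le_univ S)
  have : NeZero n := ⟨hn.ne'⟩
  have log_ge : 2 / ρ * (1 + |Real.log δ|) ≤ Real.log (n / k) := by
    rw [Real.le_log_iff_exp_le (by positivity), le_div_iff₀ hk', ← le_div_iff₀' (Real.exp_pos _),
      div_eq_inv_mul, ← Real.exp_neg]
    exact hs.card_le.trans (by gcongr)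
  have chernoff := card_le_overlap_le S k (z := n / k) (u := ρ * k) (by positivity) (by positivity)
  have mean_mul : (n / k : ℝ) * meanOverlap S k = k := by
    rw [meanOverlap, hS, Fintype.card_fin]
    field_simp
  rw [mean_mul, Fintype.card_fin] at chernoff
  calc _ ≤ n.choose k * Real.exp (k - ρ * k * Real.log (n / k)) * Real.exp (D * m) := by gcongr
    _ = n.choose k * Real.exp (k - ρ * k * Real.log (n / k) + D * m) := by
        rw [mul_assoc, ← Real.exp_add]
    _ ≤ n.choose k * δ := by
        gcongr
        exact exp_far_overlap_le hδ hD hρ (by exact_mod_cast hk) hη log_ge hs.sample_le_log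

lemma SmallSample.overlap_sum_le {n k m : ℕ} {S : Finset (Fin n)} {C D ρ η δ B q : ℝ}
    (hs : SmallSample η n k m) (hk : 0 < k) (hS : S.card = k) (hC : 0 ≤ C) (hD : 0 ≤ D)
    (hρ : 0 < ρ) (hδ : 0 < δ) (hη : 0 ≤ η) (hq0 : 0 ≤ q) (hq : q ≤ 1 / 2) (hqδ : 2 * q ≤ δ)
    (hB : Real.exp 1 ≤ B) (hBq : Real.exp 1 ≤ q * √B)
    (near : C * B ^ 2 * η ≤ Real.log (1 + δ)) (mid : C * η ≤ 1 / 2) (far : D * η ≤ ρ / 2)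
    (hηδ : η ≤ Real.exp (-(2 / ρ * (1 + |Real.log δ|)))) {g : Finset (Fin n) → ℝ}
    (g_le : ∀ T, T.card = k → ((S ∩ T).card : ℝ) ≤ ρ * k →
      g T ≤ Real.exp (C * m * ((S ∩ T).card / k : ℝ) ^ 2))
    (g_le_far : ∀ T, T.card = k → g T ≤ Real.exp (D * m)) :
    ∑ T ∈ Finset.univ.powersetCard k, g T ≤ n.choose k * (1 + 3 * δ) := by
  have hk' : (0 : ℝ) < k := by exact_mod_cast hk
  have hn : (0 : ℝ) < n := by
    exact_mod_cast hk.trans_le (by simpa [hS] using Finset.card_le_univ S)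
  have mean_eq : meanOverlap S k = (k : ℝ) ^ 2 / n := by
    rw [meanOverlap, hS, Fintype.card_fin, sq]
  have B_pos : 0 < B := (Real.exp_pos 1).trans_le hB
  have mid_le := sum_exp_overlap_gt_le (S := S) (k := k) (a := C * m / (k : ℝ) ^ 2)
    (Finset.card_pos.1 (hS ▸ hk)) hk B_pos.le hq0 hq hBq fun t ht htk => by
      rw [mean_eq] at ht ⊢
      rw [hS] at htk
      exact overlap_linear_le_half_log hk' hn hC mid hη hs.sample_le_log
        (le_trans (by gcongr) ht.le) htk
  have far_le := card_far_overlap_mul_exp_le hk hS hδ hD hρ far hηδ hs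
  have split := sum_le_near_add_mid_add_far (𝒯 := Finset.univ.powersetCard k) (g := g)
    (r := fun T => ((S ∩ T).card : ℝ)) (s := B * meanOverlap S k) (s' := ρ * k) (a := 1 + δ)
    (F := fun T => Real.exp (C * m / (k : ℝ) ^ 2 * ((S ∩ T).card : ℝ) ^ 2))
    (by positivity) (fun _ => (Real.exp_pos _).le)
    (fun T _ hT => exp_near_overlap_le hk' hn m.cast_nonneg hC hδ near hs.sample_le_sq
      (Nat.cast_nonneg _) (mean_eq ▸ hT))
    (fun T hT hTρ => (g_le T (Finset.mem_powersetCard.1 hT).2 hTρ).trans_eq (by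
      congr 1
      ring))
    (fun T hT => g_le_far T (Finset.mem_powersetCard.1 hT).2)
  rw [Finset.card_powersetCard, Finset.card_univ, Fintype.card_fin] at split
  rw [Fintype.card_fin] at mid_le
  calc _ ≤ _ := split
    _ ≤ n.choose k * (1 + δ) + n.choose k * δ + n.choose k * δ := by
        gcongr
        exact mid_le.trans (by gcongr)
    _ = n.choose k * (1 + 3 * δ) := by ring

lemma exists_overlap_sum_le {ε C D ρ : ℝ} (hε : 0 < ε) (hC : 0 ≤ C) (hD : 0 ≤ D) (hρ : 0 < ρ) :
    ∃ η > 0, ∀ (n k m : ℕ) (S : Finset (Fin n)), 0 < k → S.card = k → SmallSample η n k m →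
      ∀ g : Finset (Fin n) → ℝ,
      (∀ T, T.card = k → ((S ∩ T).card : ℝ) ≤ ρ * k →
        g T ≤ Real.exp (C * m * ((S ∩ T).card / k : ℝ) ^ 2)) →
      (∀ T, T.card = k → g T ≤ Real.exp (D * m)) →
      ∑ T ∈ Finset.univ.powersetCard k, g T ≤ n.choose k * (1 + ε) := by
  set δ : ℝ := ε / 3
  set q : ℝ := min (1 / 2) (δ / 2)
  have hδ : 0 < δ := by positivity
  have q_pos : 0 < q := lt_min (by norm_num) (by positivity)
  have q_le_half : q ≤ 1 / 2 := min_le_left _ _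
  have q_le : q ≤ δ / 2 := min_le_right _ _
  set B : ℝ := (Real.exp 1 / q) ^ 2
  have sqrt_B : √B = Real.exp 1 / q := Real.sqrt_sq (by positivity)
  have exp_le_B : Real.exp 1 ≤ B := by
    have le_div : Real.exp 1 ≤ Real.exp 1 / q := le_div_self (by positivity) q_pos (by linarith)
    exact le_div.trans
      (le_self_pow₀ ((Real.one_le_exp zero_le_one).trans le_div) two_ne_zero)
  obtain ⟨η, hη, hη_le⟩ := exists_pos_forall_mul_le ![C * B ^ 2, C, D, 1]
    (b := ![Real.log (1 + δ), 1 / 2, ρ / 2, Real.exp (-(2 / ρ * (1 + |Real.log δ|)))]) (by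
      have := Real.log_pos (by linarith : 1 < 1 + δ)
      simp only [Fin.forall_fin_succ]
      exact ⟨this, by norm_num, half_pos hρ, Real.exp_pos _, nofun⟩)
  refine ⟨η, hη, fun n k m S hk hS hs g g_le g_le_far => ?_⟩
  rw [show ε = 3 * δ by ring]
  exact hs.overlap_sum_le hk hS hC hD hρ hδ hη.le q_pos.le q_le_half (by linarith) exp_le_B
    (by rw [sqrt_B, mul_div_cancel₀ _ q_pos.ne']) (hη_le 0) (hη_le 1) (hη_le 2)
    (by simpa using hη_le 3) g_le g_le_far

/-! ### The second moment method -/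

section SecondMoment

open scoped BigOperators

lemma sum_abs_inv_card_sub_le {X : Type*} [Fintype X] [Nonempty X] {f : X → ℝ} {ε ε₁ ε₂ : ℝ}
    (hε : 0 ≤ ε) (hεε : 2 * ε₁ + ε₂ ≤ ε ^ 2) (mass : 1 - ε₁ ≤ ∑ x, f x)
    (second : Fintype.card X * ∑ x, f x ^ 2 ≤ 1 + ε₂) :
    ∑ x, |(Fintype.card X : ℝ)⁻¹ - f x| ≤ ε := by
  have card_ne_zero : (Fintype.card X : ℝ) ≠ 0 := by exact_mod_cast Fintype.card_ne_zero
  refine le_of_sq_le_sq ?_ hε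
  calc (∑ x, |(Fintype.card X : ℝ)⁻¹ - f x|) ^ 2
      ≤ Fintype.card X * ∑ x, |(Fintype.card X : ℝ)⁻¹ - f x| ^ 2 := sq_sum_le_card_mul_sum_sq
    _ = 1 - 2 * ∑ x, f x + Fintype.card X * ∑ x, f x ^ 2 := by
        simp only [sq_abs, sub_sq, Finset.sum_add_distrib, Finset.sum_sub_distrib, Finset.sum_const,
          Finset.card_univ, nsmul_eq_mul, ← Finset.mul_sum]
        field_simp
    _ ≤ ε ^ 2 := by linarith

lemma one_sub_le_expect_add_sum_mul {X : Type*} [Fintype X] [Nonempty X] {f φ : X → ℝ} {ε : ℝ}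
    (h0 : ∀ x, 0 ≤ φ x) (h1 : ∀ x, φ x ≤ 1)
    (hf : ∑ x, |(Fintype.card X : ℝ)⁻¹ - f x| ≤ ε) :
    1 - ε ≤ (𝔼 x, φ x) + ∑ x, f x * (1 - φ x) := by
  have le_abs : ∑ x, ((Fintype.card X : ℝ)⁻¹ - f x) * (1 - φ x) ≤
      ∑ x, |(Fintype.card X : ℝ)⁻¹ - f x| := Finset.sum_le_sum fun x _ =>
    (mul_le_mul_of_nonneg_right (le_abs_self _) (sub_nonneg.2 (h1 x))).trans
      (mul_le_of_le_one_right (abs_nonneg _) (sub_le_self _ (h0 x)))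
  have card_ne_zero : (Fintype.card X : ℝ) ≠ 0 := by exact_mod_cast Fintype.card_ne_zero
  have expand : ∑ x, ((Fintype.card X : ℝ)⁻¹ - f x) * (1 - φ x) =
      1 - (𝔼 x, φ x) - ∑ x, f x * (1 - φ x) := by
    rw [Finset.expect_eq_sum_div_card, Finset.card_univ]
    simp only [sub_mul, Finset.sum_sub_distrib, ← Finset.mul_sum, Finset.sum_const,
      Finset.card_univ, nsmul_eq_mul]
    field_simp
  linarith

lemma mul_sum_expect_sq_le {ι X : Type*} [Fintype X] {𝒮 : Finset ι} (h𝒮 : 𝒮.Nonempty)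
    {T : ι → X → ℝ} {W a : ℝ} (h : ∀ i ∈ 𝒮, 𝔼 j ∈ 𝒮, W * ∑ x, T i x * T j x ≤ a) :
    W * ∑ x, (𝔼 i ∈ 𝒮, T i x) ^ 2 ≤ a := by
  have expand : W * ∑ x, (𝔼 i ∈ 𝒮, T i x) ^ 2 = 𝔼 i ∈ 𝒮, 𝔼 j ∈ 𝒮, W * ∑ x, T i x * T j x := by
    simp only [sq, Finset.mul_sum, Finset.expect_sum_comm, ← Finset.mul_expect, ← Finset.expect_mul]
  exact expand.trans_le (Finset.expect_le h𝒮 h)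

lemma typeIError_eq_expect (μ : Measure ℝ) [IsProbabilityMeasure μ] [μ.IsNegInvariant] {n m : ℕ}
    (φ : Test n m) : typeIError μ φ = 𝔼 x, (φ x : ℝ) := by
  simp only [typeIError, nullProb_eq, Finset.prod_const, ← Finset.mul_sum]
  rw [Finset.expect_eq_sum_div_card, Finset.card_univ, Finset.card_univ, Fintype.card_fun,
    card_config, Fintype.card_fin, inv_pow, ← div_eq_inv_mul]
  push_cast
  rfl

lemma typeIIError_le_iSup (μ : Measure ℝ) (θ : ℝ) {n m k : ℕ} (φ : Test n m)
    {S : Finset (Fin n)} (hS : S.card = k) :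
    typeIIError μ θ S φ ≤ ⨆ S : {S : Finset (Fin n) // S.card = k}, typeIIError μ θ S.1 φ :=
  le_ciSup (f := fun S : {S : Finset (Fin n) // S.card = k} => typeIIError μ θ S.1 φ)
    (Set.finite_range _).bddAbove ⟨S, hS⟩

lemma powersetCard_univ_nonempty {n k : ℕ} (hkn : k ≤ n) :
    ((Finset.univ : Finset (Fin n)).powersetCard k).Nonempty :=
  Finset.powersetCard_nonempty.2 (by rwa [Finset.card_univ, Fintype.card_fin])

/-- Lower bounds `T S` of the planted sample laws suffice, since only the type II errors see
them. This leaves room for truncation. -/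
lemma one_sub_le_risk_of_second_moment {μ : Measure ℝ} [IsProbabilityMeasure μ]
    [μ.IsNegInvariant] {θ : ℝ} {n m k : ℕ} (hkn : k ≤ n) (φ : Test n m)
    {T : Finset (Fin n) → (Fin m → Config n) → ℝ} {ε ε₁ ε₂ : ℝ} (hε : 0 ≤ ε)
    (hεε : 2 * ε₁ + ε₂ ≤ ε ^ 2)
    (T_le : ∀ S x, T S x ≤ ∏ j, plantedProb μ θ S (x j))
    (mass : ∀ S : Finset (Fin n), S.card = k → 1 - ε₁ ≤ ∑ x, T S x)
    (second : ∀ S : Finset (Fin n), S.card = k →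
      ∑ S' ∈ Finset.univ.powersetCard k, ((2 : ℝ) ^ n) ^ m * ∑ x, T S x * T S' x ≤
        n.choose k * (1 + ε₂)) :
    1 - ε ≤ risk μ θ k φ := by
  set 𝒮 := (Finset.univ : Finset (Fin n)).powersetCard k
  have nonempty : 𝒮.Nonempty := powersetCard_univ_nonempty hkn
  have card_eq : ∀ S ∈ 𝒮, S.card = k := fun S hS => (Finset.mem_powersetCard.1 hS).2
  set f : (Fin m → Config n) → ℝ := fun x => 𝔼 S ∈ 𝒮, T S x
  have mass_f : 1 - ε₁ ≤ ∑ x, f x := by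
    rw [← Finset.expect_sum_comm]
    exact Finset.le_expect nonempty fun S hS => mass S (card_eq S hS)
  have second_f : (Fintype.card (Fin m → Config n) : ℝ) * ∑ x, f x ^ 2 ≤ 1 + ε₂ := by
    rw [Fintype.card_fun, card_config, Fintype.card_fin]
    push_cast
    refine mul_sum_expect_sq_le nonempty fun S hS => ?_
    rw [Finset.expect_eq_sum_div_card, div_le_iff₀' (by exact_mod_cast nonempty.card_pos),
      Finset.card_powersetCard, Finset.card_univ, Fintype.card_fin]
    exact second S (card_eq S hS)
  have typeII : ∑ x, f x * (1 - φ x) ≤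
      ⨆ S : {S : Finset (Fin n) // S.card = k}, typeIIError μ θ S.1 φ := by
    simp only [f, Finset.expect_mul, ← Finset.expect_sum_comm]
    exact Finset.expect_le nonempty fun S hS => le_trans (Finset.sum_le_sum fun x _ =>
      mul_le_mul_of_nonneg_right (T_le S x) (sub_nonneg.2 (φ x).2.2))
      (typeIIError_le_iSup μ θ φ (card_eq S hS))
  calc 1 - ε ≤ (𝔼 x, (φ x : ℝ)) + ∑ x, f x * (1 - φ x) :=
        one_sub_le_expect_add_sum_mul (fun x => (φ x).2.1) (fun x => (φ x).2.2)
          (sum_abs_inv_card_sub_le hε hεε mass_f second_f)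
    _ ≤ risk μ θ k φ := by
        rw [risk, typeIError_eq_expect]
        gcongr

end SecondMoment

/-! ### Truncation of the sample law -/

/-- The law of the sample under the clique `S`, restricted to samples whose total normalized
squared magnetization on `S` is at most `M` times the sample size. -/
noncomputable def truncProb (μ : Measure ℝ) (θ M : ℝ) {n m : ℕ} (S : Finset (Fin n))
    (x : Fin m → Config n) : ℝ :=
  if ∑ j, mag S (x j) ^ 2 / (S.card : ℝ) ≤ M * m then ∏ j, plantedProb μ θ S (x j) else 0

section Truncation

variable {μ : Measure ℝ} {θ M : ℝ} {n m : ℕ}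

lemma prod_plantedProb_nonneg (S : Finset (Fin n)) (x : Fin m → Config n) :
    0 ≤ ∏ j, plantedProb μ θ S (x j) :=
  Finset.prod_nonneg fun _ _ => plantedProb_nonneg μ θ S _

lemma truncProb_nonneg (S : Finset (Fin n)) (x : Fin m → Config n) :
    0 ≤ truncProb μ θ M S x :=
  ite_nonneg (prod_plantedProb_nonneg S x) le_rfl

lemma truncProb_le (S : Finset (Fin n)) (x : Fin m → Config n) :
    truncProb μ θ M S x ≤ ∏ j, plantedProb μ θ S (x j) := by
  unfold truncProb
  split_ifs
  exacts [le_rfl, prod_plantedProb_nonneg S x]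

lemma sum_truncProb_mul_le_pow (S S' : Finset (Fin n)) :
    ((2 : ℝ) ^ n) ^ m * ∑ x : Fin m → Config n, truncProb μ θ M S x * truncProb μ θ M S' x ≤
      ((2 : ℝ) ^ n * ∑ σ, plantedProb μ θ S σ * plantedProb μ θ S' σ) ^ m := by
  rw [mul_pow]
  gcongr
  rw [Fintype.sum_pow]
  refine Finset.sum_le_sum fun x _ => ?_
  rw [Finset.prod_mul_distrib]
  exact mul_le_mul (truncProb_le S x) (truncProb_le S' x) (truncProb_nonneg S' x)
    (prod_plantedProb_nonneg S x)

lemma prod_sub_truncProb_le {c : ℝ} (hc : 0 ≤ c) (S : Finset (Fin n)) (x : Fin m → Config n) :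
    ∏ j, plantedProb μ θ S (x j) - truncProb μ θ M S x ≤
      ∏ j, (plantedProb μ θ S (x j) * Real.exp (c * (mag S (x j) ^ 2 / S.card)) *
        Real.exp (-(c * M))) := by
  have prod_nonneg := prod_plantedProb_nonneg (μ := μ) (θ := θ) S x
  rw [Finset.prod_mul_distrib, Finset.prod_mul_distrib, ← Real.exp_sum, ← Finset.mul_sum,
    Finset.prod_const, Finset.card_univ, Fintype.card_fin, ← Real.exp_nat_mul, mul_assoc,
    ← Real.exp_add]
  unfold truncProb
  split_ifs with h
  · rw [sub_self]
    positivity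
  · rw [sub_zero]
    refine le_mul_of_one_le_right prod_nonneg (Real.one_le_exp ?_)
    linarith [mul_le_mul_of_nonneg_left (not_le.1 h).le hc]

variable [IsProbabilityMeasure μ]

lemma sum_prod_plantedProb (S : Finset (Fin n)) :
    ∑ x : Fin m → Config n, ∏ j, plantedProb μ θ S (x j) = 1 := by
  rw [← Fintype.sum_pow, sum_plantedProb, one_pow]

lemma one_sub_le_sum_truncProb {c C ε : ℝ} (hc : 0 ≤ c) {S : Finset (Fin n)}
    (hC : ∑ σ, plantedProb μ θ S σ * Real.exp (c * (mag S σ ^ 2 / S.card)) ≤ C)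
    (hε0 : 0 ≤ ε) (hε : ε ≤ 1) (hM : C * Real.exp (-(c * M)) ≤ ε) :
    1 - ε ≤ ∑ x : Fin m → Config n, truncProb μ θ M S x := by
  rcases Nat.eq_zero_or_pos m with rfl | hm
  · simp [truncProb, hε0]
  set tail : ℝ := (∑ σ, plantedProb μ θ S σ * Real.exp (c * (mag S σ ^ 2 / S.card))) *
    Real.exp (-(c * M))
  have tail_nonneg : 0 ≤ tail := mul_nonneg (Finset.sum_nonneg fun σ _ =>
    mul_nonneg (plantedProb_nonneg μ θ S σ) (Real.exp_pos _).le) (Real.exp_pos _).le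
  have tail_le : tail ≤ ε := (mul_le_mul_of_nonneg_right hC (Real.exp_pos _).le).trans hM
  have chernoff : 1 - ∑ x : Fin m → Config n, truncProb μ θ M S x ≤ tail ^ m := by
    rw [← sum_prod_plantedProb (μ := μ) (θ := θ) S, ← Finset.sum_sub_distrib]
    simp only [tail, Finset.sum_mul, Fintype.sum_pow]
    exact Finset.sum_le_sum fun x _ => prod_sub_truncProb_le hc S x
  linarith [pow_le_of_le_one tail_nonneg (tail_le.trans hε) hm.ne']

variable [μ.IsNegInvariant]

lemma truncProb_sq_le (hθ : 0 ≤ θ) (S : Finset (Fin n)) (x : Fin m → Config n) :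
    ((2 : ℝ) ^ n) ^ m * truncProb μ θ M S x ^ 2 ≤
      (∏ j, plantedProb μ θ S (x j)) * Real.exp (θ / 2 * M * m) := by
  have prod_nonneg := prod_plantedProb_nonneg (μ := μ) (θ := θ) S x
  unfold truncProb
  split_ifs with h
  · rw [sq, mul_left_comm]
    gcongr
    calc ((2 : ℝ) ^ n) ^ m * ∏ j, plantedProb μ θ S (x j)
        = ∏ j, ((2 : ℝ) ^ n * plantedProb μ θ S (x j)) := by
          rw [Finset.prod_mul_distrib, Finset.prod_const, Finset.card_univ, Fintype.card_fin]
      _ ≤ ∏ j, Real.exp (θ / 2 * (mag S (x j) ^ 2 / S.card)) := by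
          gcongr with j
          · exact fun j _ => mul_nonneg (by positivity) (plantedProb_nonneg μ θ S _)
          · rw [← le_inv_mul_iff₀ (by positivity)]
            refine (plantedProb_le hθ S (x j)).trans_eq ?_
            ring_nf
      _ = Real.exp (θ / 2 * ∑ j, mag S (x j) ^ 2 / (S.card : ℝ)) := by
          rw [← Real.exp_sum, Finset.mul_sum]
      _ ≤ Real.exp (θ / 2 * M * m) := by
          rw [mul_assoc]
          gcongr
  · rw [zero_pow two_ne_zero, mul_zero]
    positivity

lemma sum_truncProb_sq_le (hθ : 0 ≤ θ) (S : Finset (Fin n)) :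
    ((2 : ℝ) ^ n) ^ m * ∑ x : Fin m → Config n, truncProb μ θ M S x ^ 2 ≤
      Real.exp (θ / 2 * M * m) := by
  rw [Finset.mul_sum]
  refine (Finset.sum_le_sum fun x _ => truncProb_sq_le hθ S x).trans_eq ?_
  rw [← Finset.sum_mul, sum_prod_plantedProb, one_mul]

lemma sum_truncProb_mul_le (hθ : 0 ≤ θ) (S S' : Finset (Fin n)) :
    ((2 : ℝ) ^ n) ^ m * ∑ x : Fin m → Config n, truncProb μ θ M S x * truncProb μ θ M S' x ≤
      Real.exp (θ / 2 * M * m) := by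
  have am_gm : 2 * ∑ x : Fin m → Config n, truncProb μ θ M S x * truncProb μ θ M S' x ≤
      ∑ x : Fin m → Config n, truncProb μ θ M S x ^ 2 +
        ∑ x : Fin m → Config n, truncProb μ θ M S' x ^ 2 := by
    rw [← Finset.sum_add_distrib, Finset.mul_sum]
    refine Finset.sum_le_sum fun x _ => ?_
    rw [← mul_assoc]
    exact two_mul_le_add_sq _ _
  have := mul_le_mul_of_nonneg_left am_gm (by positivity : (0 : ℝ) ≤ ((2 : ℝ) ^ n) ^ m)
  linarith [sum_truncProb_sq_le (μ := μ) (M := M) (m := m) hθ S,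
    sum_truncProb_sq_le (μ := μ) (M := M) (m := m) hθ S']

end Truncation

lemma correlation_pow_le {a r K : ℝ} (ha : 0 ≤ a) (h : a ≤ 1 + K * r) (m : ℕ) :
    a ^ m ≤ Real.exp (K * m * r) := by
  rw [mul_right_comm, mul_comm, Real.exp_nat_mul]
  gcongr
  linarith [Real.add_one_le_exp (K * r)]

lemma HighTemperature.exists_risk_ge {μ : Measure ℝ} [IsProbabilityMeasure μ] [μ.IsNegInvariant]
    {θ : ℝ} (hθ : HighTemperature μ θ) {ε : ℝ} (hε : 0 < ε) :
    ∃ η > 0, ∀ n k m : ℕ, 0 < k → k ≤ n → SmallSample η n k m →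
      ∀ φ : Test n m, 1 - ε ≤ risk μ θ k φ := by
  obtain ⟨c, hc, C, exp_moment_le⟩ := hθ.exists_sum_plantedProb_exp_le
  obtain ⟨ρ, hρ, K, hK, correlation_le⟩ := hθ.exists_correlation_le
  set ε₁ : ℝ := min 1 (ε ^ 2 / 4)
  have ε₁_pos : 0 < ε₁ := lt_min one_pos (by positivity)
  have ε₁_le : ε₁ ≤ ε ^ 2 / 4 := min_le_right _ _
  obtain ⟨M, hM0, hM⟩ : ∃ M : ℝ, 0 ≤ M ∧ C * Real.exp (-(c * M)) ≤ ε₁ := by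
    have tendsto : Tendsto (fun M : ℝ => C * Real.exp (-(c * M))) atTop (nhds (C * 0)) :=
      (Real.tendsto_exp_neg_atTop_nhds_zero.comp (tendsto_id.const_mul_atTop hc)).const_mul C
    rw [mul_zero] at tendsto
    exact ((eventually_ge_atTop 0).and (tendsto.eventually_le_const ε₁_pos)).exists
  have θ_pos := hθ.1
  obtain ⟨η, hη, overlap_sum_le⟩ := exists_overlap_sum_le (ε := ε ^ 2 / 2) (C := K)
    (D := θ / 2 * M) (by positivity) hK (by positivity) hρ
  refine ⟨η, hη, fun n k m hk hkn hs φ => ?_⟩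
  refine one_sub_le_risk_of_second_moment hkn φ (T := truncProb μ θ M) hε.le (ε₁ := ε₁)
    (ε₂ := ε ^ 2 / 2) (by linarith) truncProb_le (fun S hS => ?_) fun S hS => ?_
  · exact one_sub_le_sum_truncProb hc.le (exp_moment_le n S (Finset.card_pos.1 (hS ▸ hk)))
      ε₁_pos.le (min_le_left _ _) hM
  · refine overlap_sum_le n k m S hk hS hs _ (fun S' hS' hr => ?_)
      fun S' _ => sum_truncProb_mul_le θ_pos.le S S'
    refine (sum_truncProb_mul_le_pow S S').trans
      (correlation_pow_le ?_ (correlation_le n k S S' hk hS hS' hr) m)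
    exact mul_nonneg (by positivity) (Finset.sum_nonneg fun σ _ =>
      mul_nonneg (plantedProb_nonneg μ θ S σ) (plantedProb_nonneg μ θ S' σ))

lemma one_le_risk_of_no_sample (μ : Measure ℝ) (θ : ℝ) {n k : ℕ} (hkn : k ≤ n) (φ : Test n 0) :
    1 ≤ risk μ θ k φ := by
  obtain ⟨S, hS⟩ := powersetCard_univ_nonempty hkn
  have errors_add : typeIError μ φ + typeIIError μ θ S φ = 1 := by
    simp [typeIError, typeIIError]
  unfold risk
  linarith [typeIIError_le_iSup μ θ φ (Finset.mem_powersetCard.1 hS).2]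

lemma HighTemperature.allTestsPowerless {μ : Measure ℝ} [IsProbabilityMeasure μ]
    [μ.IsNegInvariant] {θ : ℝ} (hθ : HighTemperature μ θ) {k m : ℕ → ℕ}
    (hk : ∀ᶠ n in atTop, 0 < k n ∧ k n ≤ n)
    (hs : ∀ η : ℝ, 0 < η → ∀ᶠ n in atTop, m n = 0 ∨ SmallSample η n (k n) (m n)) :
    AllTestsPowerless μ θ k m := by
  intro φ ε hε
  obtain ⟨η, hη, risk_ge⟩ := hθ.exists_risk_ge hε
  filter_upwards [hk, hs η hη] with n ⟨hk0, hkn⟩ hsn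
  rcases hsn with no_sample | hsn
  · have one_le : ∀ {m : ℕ}, m = 0 → ∀ φ : Test n m, 1 ≤ risk μ θ (k n) φ := by
      rintro m rfl φ
      exact one_le_risk_of_no_sample μ θ hkn φ
    linarith [one_le no_sample (φ n)]
  · exact risk_ge n (k n) (m n) hk0 hkn hsn (φ n)

/-! ### Asymptotic regimes -/

/-- If `k ^ 3 ≤ n ^ 2` then `log (n / k)` and `log n` are comparable; otherwise
`n ^ 2 / k ^ 2 ≤ k`, and the second threshold is below the first one. -/
lemma smallSample_of_le {n k m : ℕ} {η δ : ℝ} (hm : 0 < m) (hk : 0 < k) (hkn : k ≤ n)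
    (hδ : 0 < δ) (hδη : δ ≤ η) (hδe : δ ≤ Real.exp (-1))
    (sample_le_log : (m : ℝ) ≤ δ / 3 * (k * Real.log n))
    (sample_le_sq : (m : ℝ) ≤ δ ^ 2 * ((n : ℝ) ^ 2 / (k : ℝ) ^ 2)) : SmallSample η n k m := by
  have hk' : (0 : ℝ) < k := by exact_mod_cast hk
  have hn : (0 : ℝ) < n := by exact_mod_cast hk.trans_le hkn
  have hδ_sq : δ ^ 2 ≤ δ := pow_le_of_le_one hδ.le
    (hδe.trans (Real.exp_le_one_iff.2 (by norm_num))) two_ne_zero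
  have card_le : (k : ℝ) ≤ δ * n := by
    have one_le : 1 ≤ δ ^ 2 * ((n : ℝ) ^ 2 / (k : ℝ) ^ 2) :=
      le_trans (by exact_mod_cast hm) sample_le_sq
    rw [← mul_div_assoc, one_le_div (by positivity), ← mul_pow] at one_le
    exact le_of_sq_le_sq one_le (by positivity)
  have one_le_log : 1 ≤ Real.log (n / k) := by
    rw [Real.le_log_iff_exp_le (by positivity), le_div_iff₀ hk', ← le_div_iff₀' (Real.exp_pos _),
      div_eq_inv_mul, ← Real.exp_neg]
    exact card_le.trans (by gcongr)
  refine ⟨card_le.trans (by gcongr), ?_, sample_le_sq.trans (by gcongr; exact hδ_sq.trans hδη)⟩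
  rcases le_total ((k : ℝ) ^ 3) ((n : ℝ) ^ 2) with sparse | dense
  · have log_le : Real.log n ≤ 3 * Real.log (n / k) := by
      have := Real.log_le_log (by positivity) sparse
      rw [Real.log_pow, Real.log_pow] at this
      rw [Real.log_div hn.ne' hk'.ne']
      push_cast at this
      linarith
    calc (m : ℝ) ≤ δ / 3 * (k * Real.log n) := sample_le_log
      _ ≤ δ / 3 * (k * (3 * Real.log (n / k))) := by gcongr
      _ = δ * (k * Real.log (n / k)) := by ring
      _ ≤ η * (k * Real.log (n / k)) := by gcongr
  · calc (m : ℝ) ≤ δ ^ 2 * ((n : ℝ) ^ 2 / (k : ℝ) ^ 2) := sample_le_sq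
      _ ≤ η * ((k : ℝ) ^ 3 / (k : ℝ) ^ 2) := by
          have := hδ_sq.trans hδη
          have := hδ.le.trans hδη
          gcongr
      _ = η * (k * 1) := by field_simp
      _ ≤ η * (k * Real.log (n / k)) := by
          have := hδ.le.trans hδη
          gcongr

lemma smallSample_of_isLittleO {k m : ℕ → ℕ} (hk : ∀ᶠ n in atTop, 0 < k n ∧ k n ≤ n)
    (hm_log : (fun n => (m n : ℝ)) =o[atTop] fun n : ℕ => (k n : ℝ) * Real.log n)
    (hm_sq : (fun n => (m n : ℝ)) =o[atTop] fun n : ℕ => (n : ℝ) ^ 2 / (k n : ℝ) ^ 2)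
    {η : ℝ} (hη : 0 < η) : ∀ᶠ n in atTop, m n = 0 ∨ SmallSample η n (k n) (m n) := by
  have hδ : 0 < min η (Real.exp (-1)) := lt_min hη (Real.exp_pos _)
  filter_upwards [hk, hm_log.bound (div_pos hδ three_pos), hm_sq.bound (pow_pos hδ 2)]
    with n ⟨hk0, hkn⟩ sample_le_log sample_le_sq
  rw [Real.norm_of_nonneg (by positivity), Real.norm_of_nonneg (by positivity)]
    at sample_le_log sample_le_sq
  exact (m n).eq_zero_or_pos.imp_right fun hm => smallSample_of_le hm hk0 hkn hδ
    (min_le_left _ _) (min_le_right _ _) sample_le_log sample_le_sq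

lemma half_le_log {x : ℝ} (hx : 2 ≤ x) : 1 / 2 ≤ Real.log x := by
  linarith [Real.log_two_gt_d9, Real.log_le_log two_pos hx]

lemma rpow_two_thirds_pow_three {x : ℝ} (hx : 0 ≤ x) : (x ^ (2 / 3 : ℝ)) ^ 3 = x ^ 2 := by
  rw [← Real.rpow_natCast, ← Real.rpow_mul hx, ← Real.rpow_natCast]
  norm_num

lemma pow_three_mul_log_le {x y : ℝ} (hx : 2 ≤ x) (hy : 0 < y) (hxy : x ^ 3 ≤ y ^ 2) :
    x ^ 3 * Real.log y ≤ 4 * (y ^ 2 * Real.log x) := by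
  have log_x := half_le_log hx
  have log_y_nonneg : 0 ≤ Real.log y := Real.log_nonneg
    ((one_le_sq_iff₀ hy.le).1 ((one_le_pow₀ (by linarith)).trans hxy))
  rcases le_total (x ^ 2) y with small | large
  · have x_le : x ≤ √y := Real.le_sqrt_of_sq_le small
    have log_y : Real.log y ≤ 2 * √y := by
      linarith [Real.log_sqrt hy.le, Real.log_le_self (Real.sqrt_nonneg y)]
    calc x ^ 3 * Real.log y ≤ √y ^ 3 * (2 * √y) := by gcongr
      _ = 2 * (√y ^ 2) ^ 2 := by ring
      _ = 4 * (y ^ 2 * (1 / 2)) := by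
          rw [Real.sq_sqrt hy.le]
          ring
      _ ≤ 4 * (y ^ 2 * Real.log x) := by gcongr
  · have log_y : Real.log y ≤ 2 * Real.log x := by
      simpa using Real.log_le_log hy large
    calc x ^ 3 * Real.log y ≤ y ^ 2 * (2 * Real.log x) := by gcongr
      _ ≤ 4 * (y ^ 2 * Real.log x) := by
          have : 0 ≤ y ^ 2 * Real.log x := by positivity
          linarith

lemma isBigO_div_log_mul_log {k : ℕ → ℕ} (hk : ∀ᶠ n in atTop, 2 ≤ k n) :
    (fun n : ℕ => (k n : ℝ) / Real.log (k n) * Real.log n) =O[atTop]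
      fun n : ℕ => (k n : ℝ) * Real.log n := by
  refine IsBigO.mul (IsBigO.of_bound 2 ?_) (isBigO_refl _ _)
  filter_upwards [hk] with n hkn
  have log_ge := half_le_log (x := k n) (by exact_mod_cast hkn)
  rw [Real.norm_of_nonneg (by positivity), Real.norm_of_nonneg (by positivity),
    div_le_iff₀ (by linarith), mul_right_comm]
  exact le_mul_of_one_le_left (by positivity) (by linarith)

lemma isBigO_div_log_mul_log_sq_div_sq {k : ℕ → ℕ} (hk : ∀ᶠ n in atTop, 2 ≤ k n)
    (hk_sparse : (fun n => (k n : ℝ)) =o[atTop] fun n : ℕ => (n : ℝ) ^ (2 / 3 : ℝ)) :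
    (fun n : ℕ => (k n : ℝ) / Real.log (k n) * Real.log n) =O[atTop]
      fun n : ℕ => (n : ℝ) ^ 2 / (k n : ℝ) ^ 2 := by
  refine IsBigO.of_bound 4 ?_
  filter_upwards [hk, hk_sparse.bound one_pos, eventually_gt_atTop 0] with n hkn hkn_sparse hn
  have hk2 : (2 : ℝ) ≤ k n := by exact_mod_cast hkn
  have hn' : (0 : ℝ) < n := by exact_mod_cast hn
  have log_pos : 0 < Real.log (k n) := by linarith [half_le_log hk2]
  rw [one_mul, Real.norm_of_nonneg (by positivity), Real.norm_of_nonneg (by positivity)]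
    at hkn_sparse
  have pow_three_le : (k n : ℝ) ^ 3 ≤ (n : ℝ) ^ 2 := by
    rw [← rpow_two_thirds_pow_three hn'.le]
    gcongr
  rw [Real.norm_of_nonneg (by positivity), Real.norm_of_nonneg (by positivity),
    div_mul_eq_mul_div, div_le_iff₀ log_pos, ← mul_div_assoc, div_mul_eq_mul_div,
    le_div_iff₀ (by positivity)]
  linarith [pow_three_mul_log_le hk2 hn' pow_three_le]

lemma isBigO_sq_div_sq {k : ℕ → ℕ} (hk : ∀ᶠ n in atTop, 0 < k n)
    (hk_dense : (fun n : ℕ => (n : ℝ) ^ (2 / 3 : ℝ)) =O[atTop] fun n => (k n : ℝ)) :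
    (fun n : ℕ => (n : ℝ) ^ 2 / (k n : ℝ) ^ 2) =O[atTop]
      fun n : ℕ => (k n : ℝ) * Real.log n := by
  obtain ⟨K, hK, hkK⟩ := hk_dense.exists_pos
  refine IsBigO.of_bound (2 * K ^ 3) ?_
  filter_upwards [hk, hkK.bound, eventually_ge_atTop 2] with n hk0 hkn hn
  have hk' : (0 : ℝ) < k n := by exact_mod_cast hk0
  have log_ge := half_le_log (x := n) (by exact_mod_cast hn)
  rw [Real.norm_of_nonneg (by positivity), Real.norm_of_nonneg (by positivity)] at hkn ⊢
  calc (n : ℝ) ^ 2 / (k n : ℝ) ^ 2 = ((n : ℝ) ^ (2 / 3 : ℝ)) ^ 3 / (k n : ℝ) ^ 2 := by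
        rw [rpow_two_thirds_pow_three n.cast_nonneg]
    _ ≤ (K * k n) ^ 3 / (k n : ℝ) ^ 2 := by gcongr
    _ = 2 * K ^ 3 * (k n * (1 / 2)) := by field_simp
    _ ≤ 2 * K ^ 3 * (k n * Real.log n) := by gcongr

end PlantedRFCW

theorem mainTheorem2_general (μ : Measure ℝ) [IsProbabilityMeasure μ]
    (hμ : μ.map (fun h : ℝ => -h) = μ) (θ : ℝ) (hθ : PlantedRFCW.HighTemperature μ θ)
    (k m : ℕ → ℕ) (hk : ∀ᶠ n in atTop, 1 ≤ k n ∧ k n ≤ n)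
    (hm_log : (fun n => (m n : ℝ)) =o[atTop] (fun n : ℕ => (k n : ℝ) * Real.log n))
    (hm_sq : (fun n => (m n : ℝ)) =o[atTop] (fun n : ℕ => (n : ℝ) ^ 2 / (k n : ℝ) ^ 2)) :
    PlantedRFCW.AllTestsPowerless μ θ k m := by
  have : μ.IsNegInvariant := ⟨hμ⟩
  exact hθ.allTestsPowerless hk fun _ => PlantedRFCW.smallSample_of_isLittleO hk hm_log hm_sq

theorem mainTheorem2 (μ : Measure ℝ) [IsProbabilityMeasure μ]
    (hμ : μ.map (fun h : ℝ => -h) = μ) (θ : ℝ) (hθ : PlantedRFCW.HighTemperature μ θ)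
    (k m : ℕ → ℕ) (hk : ∀ᶠ n in atTop, 2 ≤ k n ∧ k n ≤ n) :
    ((fun n => (k n : ℝ)) =o[atTop] (fun n : ℕ => (n : ℝ) ^ (2 / 3 : ℝ)) →
      (θ < 1 / (2 * PlantedRFCW.meanSechSq μ) →
        (fun n => (m n : ℝ)) =o[atTop] (fun n : ℕ => (k n : ℝ) * Real.log n) →
        (fun n => (m n : ℝ)) =o[atTop] (fun n : ℕ => (n : ℝ) ^ 2 / (k n : ℝ) ^ 2) →
        PlantedRFCW.AllTestsPowerless μ θ k m) ∧
      (1 / (2 * PlantedRFCW.meanSechSq μ) ≤ θ →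
        (fun n => (m n : ℝ)) =o[atTop]
          (fun n : ℕ => (k n : ℝ) / Real.log (k n) * Real.log n) →
        PlantedRFCW.AllTestsPowerless μ θ k m)) ∧
    ((fun n : ℕ => (n : ℝ) ^ (2 / 3 : ℝ)) =O[atTop] (fun n => (k n : ℝ)) →
      (fun n => (m n : ℝ)) =o[atTop] (fun n : ℕ => (n : ℝ) ^ 2 / (k n : ℝ) ^ 2) →
      PlantedRFCW.AllTestsPowerless μ θ k m) := by
  have powerless := mainTheorem2_general μ hμ θ hθ k m
    (hk.mono fun _ h => ⟨one_le_two.trans h.1, h.2⟩)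
  have two_le : ∀ᶠ n in atTop, 2 ≤ k n := hk.mono fun _ h => h.1
  refine ⟨fun sparse => ⟨fun _ => powerless, fun _ hm => powerless ?_ ?_⟩, fun dense hm =>
    powerless ?_ hm⟩
  · exact hm.trans_isBigO (PlantedRFCW.isBigO_div_log_mul_log two_le)
  · exact hm.trans_isBigO (PlantedRFCW.isBigO_div_log_mul_log_sq_div_sq two_le sparse)
  · exact hm.trans_isBigO
      (PlantedRFCW.isBigO_sq_div_sq (two_le.mono fun _ => two_pos.trans_le) dense)
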